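/- For real $\alpha,\beta$ put $\rho=\alpha+\beta+1$, and for $\lambda\in\mathbb{C}$ and $t\ge 0$ let \[ \varphi^{(\alpha,\beta)}_{\lambda}(t)={}_2F_1\Bigl(\tfrac{\rho+i\lambda}{2},\tfrac{\rho-i\lambda}{2};\alpha+1;-\sinh^2 t\Bigr) \] be the Jacobi function of the first kind, where ${}_2F_1$ denotes the Gauss hypergeometric function, continued analytically from the unit disc to $\mathbb{C}\setminus[1,\infty)$. Let $\alpha>-1/2$, $-1/2\le\beta\le\alpha$, and let $0<\eta_0<\rho$. Then there exists a positive constant $C=C(\alpha,\beta,\eta_0)$ such that \[ \bigl|1-\varphi^{(\alpha,\beta)}_{\mu+i\eta}(t)\bigr|\ \ge\ C\,\min\{1,(\mu t)^2\} \] for all $\mu\in\mathbb{R}$, all $\eta\in\mathbb{R}$ with $|\eta|\le\eta_0$, and all $t>0$. -/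

import Mathlib

/-- The analytic continuation of the Gauss hypergeometric function `₂F₁(a, b; c; ·)` from the unit
disc to the half-plane `re z < 1/2`, given by `(1 - z)^(-a) ₂F₁(a, c - b; c; z / (z - 1))`
(principal power). The map `z ↦ z / (z - 1)` sends this half-plane onto the open unit disc, so the
series on the right converges there. That this really is the analytic continuation is proved in
`gaussHypergeometric_analyticOnNhd` and `gaussHypergeometric_eventuallyEq`. -/
noncomputable def gaussHypergeometric (a b c z : ℂ) : ℂ :=
  (1 - z) ^ (-a) * ordinaryHypergeometric a (c - b) c (z / (z - 1))

/-- `ρ = α + β + 1`. For the parameters `α = (m₁ + m₂ - 1) / 2`, `β = (m₂ - 1) / 2` of a rank one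
symmetric space with root multiplicities `m₁`, `m₂` this is `(m₁ + 2 m₂) / 2`. -/
noncomputable def jacobiRho (α β : ℝ) : ℝ := α + β + 1

/-- The Jacobi function of the first kind
`φ_l^{(α,β)}(t) = ₂F₁((ρ + i l) / 2, (ρ - i l) / 2; α + 1; - sinh² t)`, with `ρ = α + β + 1`,
where `₂F₁` is continued analytically beyond the unit disc. -/
noncomputable def jacobiFunction (α β : ℝ) (l : ℂ) (t : ℝ) : ℂ :=
  gaussHypergeometric (((jacobiRho α β : ℝ) + Complex.I * l) / 2)
    (((jacobiRho α β : ℝ) - Complex.I * l) / 2) ((α : ℂ) + 1) (-((Real.sinh t : ℝ) : ℂ) ^ 2)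

/-! ### `gaussHypergeometric` is the analytic continuation of Gauss' series -/

theorem one_le_radius_ordinaryHypergeometricSeries (a b c : ℂ) :
    1 ≤ (ordinaryHypergeometricSeries ℂ a b c).radius := by
  by_cases h : ∀ kn : ℕ, (kn : ℂ) ≠ -a ∧ (kn : ℂ) ≠ -b ∧ (kn : ℂ) ≠ -c
  · exact (ordinaryHypergeometricSeries_radius_eq_one ℂ a b c h).ge
  · push Not at h
    obtain ⟨k, hk⟩ := h
    have key : (ordinaryHypergeometricSeries ℂ a b c).radius = ⊤ := by
      refine FormalMultilinearSeries.radius_eq_top_of_forall_image_add_eq_zero _ (1 + k) fun n ↦ ?_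
      refine ordinaryHypergeometricSeries_eq_zero_of_neg_nat a b c (k := k) ?_ (by lia)
      tauto
    simp [key]

theorem norm_div_sub_one_lt_one {z : ℂ} (hz : z.re < 1 / 2) : ‖z / (z - 1)‖ < 1 := by
  have h0 : z - 1 ≠ 0 := by
    intro h
    have := congrArg Complex.re h
    simp at this
    linarith
  rw [norm_div, div_lt_one (norm_pos_iff.2 h0)]
  have h1 : ‖z‖ ^ 2 < ‖z - 1‖ ^ 2 := by
    rw [← Complex.normSq_eq_norm_sq, ← Complex.normSq_eq_norm_sq, Complex.normSq_apply,
      Complex.normSq_apply]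
    simp
    nlinarith
  exact lt_of_pow_lt_pow_left₀ 2 (norm_nonneg _) h1

theorem gaussHypergeometric_analyticOnNhd (a b c : ℂ) :
    AnalyticOnNhd ℂ (gaussHypergeometric a b c) {z | z.re < 1 / 2} := by
  intro z hz
  have hz' : z.re < 1 / 2 := hz
  have h0 : z - 1 ≠ 0 := by
    intro h
    have := congrArg Complex.re h
    simp at this
    linarith
  have hF : AnalyticAt ℂ (ordinaryHypergeometric a (c - b) c : ℂ → ℂ) (z / (z - 1)) := by
    have hr := one_le_radius_ordinaryHypergeometricSeries a (c - b) c
    refine ((ordinaryHypergeometricSeries ℂ a (c - b) c).hasFPowerSeriesOnBall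
      (lt_of_lt_of_le one_pos hr)).analyticAt_of_mem ?_
    refine Metric.eball_subset_eball hr ?_
    simpa [Metric.mem_eball, edist_zero_right, ← ofReal_norm] using
      norm_div_sub_one_lt_one hz'
  have hq : AnalyticAt ℂ (fun w : ℂ ↦ w / (w - 1)) z :=
    analyticAt_id.div (analyticAt_id.sub analyticAt_const) h0
  have hp : AnalyticAt ℂ (fun w : ℂ ↦ (1 - w) ^ (-a)) z := by
    refine (analyticAt_const.sub analyticAt_id).cpow analyticAt_const ?_
    left
    simp
    linarith
  exact hp.mul (AnalyticAt.fun_comp (g := ordinaryHypergeometric a (c - b) c) hF hq)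

theorem sum_ascPochhammer_vandermonde (N : ℕ) : ∀ c d : ℂ,
    ∑ n ∈ Finset.range (N + 1), (N.choose n : ℂ) * (-1) ^ n * (ascPochhammer ℂ n).eval d *
      (ascPochhammer ℂ (N - n)).eval (c + n) = (ascPochhammer ℂ N).eval (c - d) := by
  have hsucc : ∀ (m : ℕ) (x : ℂ), (ascPochhammer ℂ (m + 1)).eval x
      = x * (ascPochhammer ℂ m).eval (x + 1) := by
    intro m x
    simp [ascPochhammer_succ_left]
  induction N with
  | zero => simp
  | succ N ih =>
    intro c d
    have e1 : ∑ n ∈ Finset.range (N + 1 + 1), ((N + 1).choose n : ℂ) * (-1) ^ n *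
        (ascPochhammer ℂ n).eval d * (ascPochhammer ℂ (N + 1 - n)).eval (c + n) =
        ∑ n ∈ Finset.range (N + 1), (N.choose n : ℂ) * (-1) ^ n *
          (ascPochhammer ℂ n).eval d * (ascPochhammer ℂ (N + 1 - n)).eval (c + n) +
        ∑ n ∈ Finset.range (N + 1), (N.choose n : ℂ) * (-1) ^ (n + 1) *
          (ascPochhammer ℂ (n + 1)).eval d * (ascPochhammer ℂ (N - n)).eval (c + (n + 1)) := by
      rw [Finset.sum_range_succ', Finset.sum_range_succ' (fun n ↦ (N.choose n : ℂ) * (-1) ^ n *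
        (ascPochhammer ℂ n).eval d * (ascPochhammer ℂ (N + 1 - n)).eval (c + n)) N]
      have : ∑ n ∈ Finset.range N, (N.choose (n + 1) : ℂ) * (-1) ^ (n + 1) *
          (ascPochhammer ℂ (n + 1)).eval d *
          (ascPochhammer ℂ (N + 1 - (n + 1))).eval (c + (n + 1 : ℕ)) =
          ∑ n ∈ Finset.range (N + 1), (N.choose (n + 1) : ℂ) * (-1) ^ (n + 1) *
          (ascPochhammer ℂ (n + 1)).eval d *
          (ascPochhammer ℂ (N + 1 - (n + 1))).eval (c + (n + 1 : ℕ)) := by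
        rw [Finset.sum_range_succ]; simp
      rw [this, add_right_comm, ← Finset.sum_add_distrib]
      congr 1
      · refine Finset.sum_congr rfl fun n _ ↦ ?_
        rw [Nat.choose_succ_succ]
        push_cast
        rw [show N.choose n.succ = N.choose (n + 1) from rfl]
        ring
      · simp
    rw [e1, ← Finset.sum_add_distrib, hsucc, show c - d + 1 = (c + 1) - d by ring, ← ih (c + 1) d,
      Finset.mul_sum]
    refine Finset.sum_congr rfl fun n hn ↦ ?_
    have hn' : n ≤ N := by simpa [Nat.lt_succ_iff] using hn
    rw [Nat.succ_sub hn', hsucc, ascPochhammer_succ_eval, show c + 1 + (n : ℂ) = c + n + 1 by ring,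
      show c + ((n : ℂ) + 1) = c + n + 1 by ring]
    ring

theorem ascPochhammer_eval_add (a : ℂ) (n k : ℕ) : (ascPochhammer ℂ (n + k)).eval a =
    (ascPochhammer ℂ n).eval a * (ascPochhammer ℂ k).eval (a + n) := by
  rw [← ascPochhammer_mul]
  simp

theorem ring_choose_eq_ascPochhammer {K : Type*} [Field K] [CharZero K] (s : K) (k : ℕ) :
    Ring.choose (s + k - 1) k = (ascPochhammer K k).eval s / (k.factorial : K) := by
  have h := Ring.descPochhammer_eq_factorial_smul_choose (s + k - 1) k
  rw [eq_div_iff (by exact_mod_cast k.factorial_ne_zero), mul_comm, ← nsmul_eq_mul, ← h]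
  simp only [Polynomial.descPochhammer_smeval_eq_ascPochhammer,
    Polynomial.ascPochhammer_smeval_cast, Polynomial.ascPochhammer_smeval_eq_eval]
  congr 1
  ring

theorem hasSum_one_sub_cpow_neg (s : ℂ) {z : ℂ} (hz : ‖z‖ < 1) :
    HasSum (fun k : ℕ ↦ (ascPochhammer ℂ k).eval s / (k.factorial : ℂ) * z ^ k)
      ((1 - z) ^ (-s)) := by
  have h := (Complex.one_div_one_sub_cpow_hasFPowerSeriesOnBall_zero s).hasSum (y := z)
    (by simpa [Metric.mem_eball, edist_zero_right, ← ofReal_norm] using hz)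
  simp only [zero_add, one_div, ← Complex.cpow_neg] at h
  refine h.congr_fun fun k ↦ ?_
  rw [FormalMultilinearSeries.ofScalars_apply_eq, smul_eq_mul, ring_choose_eq_ascPochhammer]

theorem hasSum_one_sub_rpow_neg (s : ℝ) {r : ℝ} (hr : |r| < 1) :
    HasSum (fun k : ℕ ↦ (ascPochhammer ℝ k).eval s / (k.factorial : ℝ) * r ^ k)
      ((1 - r) ^ (-s)) := by
  have h := (Real.one_div_one_sub_rpow_hasFPowerSeriesOnBall_zero s).hasSum (y := r)
    (by simpa [Metric.mem_eball, edist_zero_right, ← ofReal_norm] using hr)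
  have h1 : 0 ≤ 1 - r := by linarith [le_abs_self r]
  simp only [zero_add, one_div, ← Real.rpow_neg h1] at h
  refine h.congr_fun fun k ↦ ?_
  rw [FormalMultilinearSeries.ofScalars_apply_eq, smul_eq_mul, ring_choose_eq_ascPochhammer]

theorem norm_ascPochhammer_eval_le (s : ℂ) (n k : ℕ) :
    ‖(ascPochhammer ℂ k).eval (s + n)‖ ≤ (ascPochhammer ℝ k).eval (‖s‖ + n) := by
  induction k with
  | zero => simp
  | succ k ih =>
    rw [ascPochhammer_succ_eval, ascPochhammer_succ_eval, norm_mul]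
    refine mul_le_mul ih ?_ (norm_nonneg _) ((norm_nonneg _).trans ih)
    refine (norm_add_le _ _).trans (add_le_add ((norm_add_le _ _).trans ?_) ?_) <;> simp

theorem gaussHypergeometric_eq_of_norm_lt (a b c : ℂ) (hc : ∀ k : ℕ, c ≠ -(k : ℂ)) {z : ℂ}
    (hz : ‖z‖ < 1 / 3) : gaussHypergeometric a b c z = ordinaryHypergeometric a b c z := by
  set r := ‖z‖ with hrdef
  have hr0 : 0 ≤ r := norm_nonneg z
  have hcn : ∀ n : ℕ, (ascPochhammer ℂ n).eval c ≠ 0 := by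
    intro n h
    obtain ⟨k, -, hk⟩ := (ascPochhammer_eval_eq_zero_iff n c).1 h
    exact hc k (by rw [hk, neg_neg])
  have h1z : 1 - z ≠ 0 := by
    intro h
    have : z = 1 := by linear_combination -h
    rw [hrdef, this] at hz
    norm_num at hz
  let A : ℕ → ℂ := fun n ↦ ordinaryHypergeometricCoefficient a (c - b) c n
  let T : ℕ × ℕ → ℂ := fun p ↦ A p.1 * (-1) ^ p.1 * z ^ p.1 *
    ((ascPochhammer ℂ p.2).eval (a + p.1) / (p.2.factorial : ℂ) * z ^ p.2)
  -- inner sums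
  have hinner : ∀ n : ℕ, HasSum (fun k ↦ T (n, k)) ((1 - z) ^ (-a) * (A n * (z / (z - 1)) ^ n)) := by
    intro n
    have h := (hasSum_one_sub_cpow_neg (a + n) (z := z) (by linarith)).mul_left
      (A n * (-1) ^ n * z ^ n)
    have e : A n * (-1) ^ n * z ^ n * (1 - z) ^ (-(a + n)) =
        (1 - z) ^ (-a) * (A n * (z / (z - 1)) ^ n) := by
      rw [neg_add, Complex.cpow_add _ _ h1z, Complex.cpow_neg _ (n : ℂ), Complex.cpow_natCast,
        div_pow, show z - 1 = -1 * (1 - z) by ring, mul_pow]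
      have h2 : ((-1 : ℂ) ^ n) * (-1) ^ n = 1 := by rw [← mul_pow]; simp
      field_simp
      linear_combination (A n * z ^ n * (1 - z) ^ (-a)) * h2
    rw [← e]
    exact h
  -- absolute summability
  have hsum : Summable T := by
    rw [← summable_norm_iff, summable_prod_of_nonneg (fun _ ↦ norm_nonneg _)]
    have hr1 : |r| < 1 := by rw [abs_of_nonneg hr0]; linarith
    have hb : ∀ n : ℕ, HasSum (fun k : ℕ ↦ ‖A n‖ * r ^ n *
        ((ascPochhammer ℝ k).eval (‖a‖ + n) / (k.factorial : ℝ) * r ^ k))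
        (‖A n‖ * r ^ n * (1 - r) ^ (-(‖a‖ + n))) := fun n ↦
      (hasSum_one_sub_rpow_neg (‖a‖ + n) hr1).mul_left _
    have hle : ∀ n k : ℕ, ‖T (n, k)‖ ≤ ‖A n‖ * r ^ n *
        ((ascPochhammer ℝ k).eval (‖a‖ + n) / (k.factorial : ℝ) * r ^ k) := by
      intro n k
      simp only [T, norm_mul, norm_pow, norm_div, norm_neg, norm_one, one_pow, mul_one,
        Complex.norm_natCast]
      gcongr
      exact norm_ascPochhammer_eval_le a n k
    have hs1 : ∀ n, Summable fun k ↦ ‖T (n, k)‖ := fun n ↦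
      Summable.of_nonneg_of_le (fun _ ↦ norm_nonneg _) (hle n) (hb n).summable
    refine ⟨hs1, ?_⟩
    have hq : Summable fun n : ℕ ↦ (1 - r) ^ (-‖a‖) * (‖A n‖ * (r / (1 - r)) ^ n) := by
      refine Summable.mul_left _ ?_
      have hq1 : r / (1 - r) < 1 := by rw [div_lt_one (by linarith)]; linarith
      have hq0 : 0 ≤ r / (1 - r) := div_nonneg hr0 (by linarith)
      have := (ordinaryHypergeometricSeries ℂ a (c - b) c).summable_norm_apply
        (x := ((r / (1 - r) : ℝ) : ℂ))
        (Metric.eball_subset_eball (one_le_radius_ordinaryHypergeometricSeries a (c - b) c) (by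
          rw [Metric.mem_eball, edist_zero_right, ← ofReal_norm, Complex.norm_real,
            Real.norm_of_nonneg hq0]
          simpa using hq1))
      refine this.congr fun n ↦ ?_
      rw [ordinaryHypergeometricSeries_apply_eq, smul_eq_mul, norm_mul, norm_pow, Complex.norm_real,
        Real.norm_of_nonneg hq0]
    refine Summable.of_nonneg_of_le (fun n ↦ tsum_nonneg fun _ ↦ norm_nonneg _) (fun n ↦ ?_) hq
    refine ((hs1 n).tsum_le_tsum (hle n) (hb n).summable).trans ?_
    rw [(hb n).tsum_eq, neg_add, Real.rpow_add (by linarith), Real.rpow_neg (by linarith) (n : ℝ),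
      Real.rpow_natCast, div_pow]
    apply le_of_eq
    have : (1 - r) ^ n ≠ 0 := pow_ne_zero _ (by linarith)
    field_simp
  -- antidiagonal sums
  have hdiag : ∀ N : ℕ, ∑ p ∈ Finset.HasAntidiagonal.antidiagonal N, T p
      = ordinaryHypergeometricCoefficient a b c N * z ^ N := by
    intro N
    have hv := sum_ascPochhammer_vandermonde N c (c - b)
    rw [sub_sub_cancel] at hv
    have hN : (N.factorial : ℂ) ≠ 0 := by exact_mod_cast N.factorial_ne_zero
    simp only [ordinaryHypergeometricCoefficient]
    rw [← hv, Finset.Nat.sum_antidiagonal_eq_sum_range_succ_mk, Finset.mul_sum, Finset.sum_mul,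
      Finset.sum_mul]
    refine Finset.sum_congr rfl fun n hn ↦ ?_
    have hn' : n ≤ N := by simpa [Nat.lt_succ_iff] using hn
    obtain ⟨k, rfl⟩ := Nat.exists_eq_add_of_le hn'
    have hn0 : (n.factorial : ℂ) ≠ 0 := by exact_mod_cast n.factorial_ne_zero
    have hk0 : (k.factorial : ℂ) ≠ 0 := by exact_mod_cast k.factorial_ne_zero
    have hch : ((n + k).choose n : ℂ) * n.factorial * k.factorial = (n + k).factorial := by
      have := Nat.choose_mul_factorial_mul_factorial hn'
      rw [Nat.add_sub_cancel_left] at this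
      exact_mod_cast this
    have hcnk : (ascPochhammer ℂ k).eval (c + n) ≠ 0 := by
      intro h
      apply hcn (n + k)
      rw [ascPochhammer_eval_add, h, mul_zero]
    have hcn' := hcn n
    have hch' : ((n + k).choose n : ℂ) = (n + k).factorial / (n.factorial * k.factorial) := by
      rw [eq_div_iff (mul_ne_zero hn0 hk0), ← hch]; ring
    simp only [T, A, ordinaryHypergeometricCoefficient, Nat.add_sub_cancel_left]
    rw [ascPochhammer_eval_add a, ascPochhammer_eval_add c, hch', pow_add]
    field_simp
  -- conclusion
  have hL : HasSum T (gaussHypergeometric a b c z) := by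
    have h := hsum.hasSum.prod_fiberwise hinner
    have h2 : ∑' p, T p = gaussHypergeometric a b c z := by
      rw [← h.tsum_eq, tsum_mul_left, gaussHypergeometric, ordinaryHypergeometric,
        ordinaryHypergeometric_sum_eq]
      rfl
    rw [← h2]
    exact hsum.hasSum
  have hL' := (Finset.HasAntidiagonal.sigmaAntidiagonalEquivProd (A := ℕ)).hasSum_iff.2 hL
  have h3 := hL'.sigma (g := fun N ↦ ordinaryHypergeometricCoefficient a b c N * z ^ N) (fun N ↦ by
    rw [← hdiag N]
    have := Finset.hasSum (Finset.HasAntidiagonal.antidiagonal N) T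
    exact this)
  rw [← h3.tsum_eq, ordinaryHypergeometric, ordinaryHypergeometric_sum_eq]
  rfl

theorem gaussHypergeometric_eventuallyEq (a b c : ℂ) (hc : ∀ k : ℕ, c ≠ -(k : ℂ)) :
    gaussHypergeometric a b c =ᶠ[nhds 0] ordinaryHypergeometric a b c := by
  filter_upwards [Metric.ball_mem_nhds (0 : ℂ) (by norm_num : (0 : ℝ) < 1 / 3)] with z hz
  exact gaussHypergeometric_eq_of_norm_lt a b c hc (by simpa using hz)

/-!
The proof rests on a positive integral formula. For `α ≥ β ≥ -1/2` there is a probability measure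
`m` on the square `[0, 1] ^ 2`, a product of two beta laws (`jacobiMeasure`), such that
`φ_l(t) = ∫ ½ (D₊ ^ (-(ρ + i l)) + D₋ ^ (-(ρ + i l))) dm` with
`D_± = |cosh t ± r e^{iψ} sinh t|` (`jacobiFunction_eq_integral`). To obtain it, put
`a = (ρ + i l) / 2` and `x = tanh t`: by definition
`φ_l(t) = (cosh t) ^ (-2a) ₂F₁(a, a - β; α + 1; x²)`, and `₂F₁(a, a - β; α + 1; w²)` is the mean of
`(1 ± 2 w r cos ψ + w² r²) ^ (-a)`. For small `w` this follows by expanding in a double binomial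
series, integrating it termwise with the moments of the beta laws, and summing the coefficients by
Chu-Vandermonde (`integral_distSq_of_norm_lt`); both sides are holomorphic in the unit disc, so it
holds there (`integral_distSq`).

Since `φ_l` is even in `l` and `φ_{iρ} = 1`, averaging over `± l` gives, with `L = log D`,
`1 - Re φ_{μ + iη}(t) = ∫ ½ ∑_± e^{-ρL} (cosh ρL - cosh ηL cos μL) dm`
(`one_sub_re_jacobiFunction`). The integrand is nonnegative for `|η| ≤ ρ`. For `t ≥ 1` one has
`L₊ ≥ log cosh 1 > 0`, and `|η| ≤ η₀ < ρ` bounds the integrand for `D₊` from below by a constant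
(`sq_div_two_le_jacobiGap`). For `t ≤ 1` the integrand is at least `e^{-ρ} (1 - cos μL)`, and
because `L₊` moves at speed comparable to `t` in one of the two variables, the mean of `1 - cos μL₊`
is at least a multiple of `min 1 ((μ t) ^ 2)` (`exists_le_integral_one_sub_cos_logDist`).
-/

open MeasureTheory ProbabilityTheory Set

/-! ### Beta laws -/

/-- The beta law with parameters `p > 0` and `q ≥ 0`; for `q = 0` it is the point mass at `1`, the
weak limit of the beta laws as `q` tends to `0`. -/
noncomputable def betaLaw (p q : ℝ) : Measure ℝ :=
  if q = 0 then Measure.dirac 1 else betaMeasure p q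

theorem betaLaw_zero (p : ℝ) : betaLaw p 0 = Measure.dirac 1 := if_pos rfl

theorem betaLaw_of_pos (p : ℝ) {q : ℝ} (hq : 0 < q) : betaLaw p q = betaMeasure p q :=
  if_neg hq.ne'

theorem isProbabilityMeasure_betaLaw {p q : ℝ} (hp : 0 < p) (hq : 0 ≤ q) :
    IsProbabilityMeasure (betaLaw p q) := by
  rcases hq.eq_or_lt with rfl | hq
  · rw [betaLaw_zero]; infer_instance
  · rw [betaLaw_of_pos p hq]; exact isProbabilityMeasureBeta hp hq

theorem measurable_betaPDF (p q : ℝ) : Measurable (betaPDF p q) :=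
  (measurable_betaPDFReal p q).ennreal_ofReal

theorem ae_betaLaw_mem_Icc (p : ℝ) {q : ℝ} (hq : 0 ≤ q) : ∀ᵐ s ∂(betaLaw p q), s ∈ Icc (0 : ℝ) 1 := by
  rcases hq.eq_or_lt with rfl | hq
  · rw [betaLaw_zero, ae_dirac_eq]; simp
  · rw [betaLaw_of_pos p hq, betaMeasure, ae_withDensity_iff (measurable_betaPDF p q)]
    refine Filter.Eventually.of_forall fun s hs ↦ ?_
    constructor
    · by_contra! h; exact hs (betaPDF_eq_zero_of_nonpos h.le)
    · by_contra! h; exact hs (betaPDF_eq_zero_of_one_le h.le)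

theorem betaPDFReal_nonneg {p q : ℝ} (hp : 0 < p) (hq : 0 < q) (s : ℝ) : 0 ≤ betaPDFReal p q s := by
  by_cases h : 0 < s ∧ s < 1
  · exact (betaPDFReal_pos h.1 h.2 hp hq).le
  · rw [betaPDFReal, if_neg h]

theorem integral_betaPDFReal {p q : ℝ} (hp : 0 < p) (hq : 0 < q) :
    ∫ s, betaPDFReal p q s = 1 := by
  rw [integral_eq_lintegral_of_nonneg_ae (Filter.Eventually.of_forall (betaPDFReal_nonneg hp hq))
    (measurable_betaPDFReal p q).aestronglyMeasurable]
  have := lintegral_betaPDF_eq_one hp hq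
  simp only [betaPDF] at this
  rw [this]; simp

theorem Real.Gamma_add_natCast {p : ℝ} (hp : 0 < p) (k : ℕ) :
    Real.Gamma (p + k) = (ascPochhammer ℝ k).eval p * Real.Gamma p := by
  induction k with
  | zero => simp
  | succ k ih =>
    rw [Nat.cast_succ, ← add_assoc, Real.Gamma_add_one (by positivity), ih,
      ascPochhammer_succ_eval]
    ring

/-- The moments of the beta law. They follow from the normalization of the beta density, because
`s ^ k` times the density with parameters `p, q` is a multiple of the density with parameters
`p + k, q`. -/
theorem integral_pow_betaLaw {p q : ℝ} (hp : 0 < p) (hq : 0 ≤ q) (k : ℕ) :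
    ∫ s, s ^ k ∂(betaLaw p q) = (ascPochhammer ℝ k).eval p / (ascPochhammer ℝ k).eval (p + q) := by
  rcases hq.eq_or_lt with rfl | hq
  · rw [betaLaw_zero, integral_dirac, add_zero, one_pow, div_self (ascPochhammer_pos k p hp).ne']
  · have hpk : 0 < p + k := by positivity
    have key : ∀ s, betaPDFReal p q s * s ^ k =
        beta (p + k) q / beta p q * betaPDFReal (p + k) q s := by
      intro s
      by_cases h : 0 < s ∧ s < 1
      · rw [betaPDFReal, betaPDFReal, if_pos h, if_pos h, show p + k - 1 = p - 1 + k by ring,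
          Real.rpow_add_natCast h.1.ne']
        have := (beta_pos hp hq).ne'
        have := (beta_pos hpk hq).ne'
        field_simp
      · rw [betaPDFReal, betaPDFReal, if_neg h, if_neg h]; simp
    rw [betaLaw_of_pos p hq, betaMeasure]
    have : betaPDF p q = fun s ↦ ENNReal.ofReal (betaPDFReal p q s) := rfl
    rw [this, integral_withDensity_eq_integral_toReal_smul
      (measurable_betaPDFReal p q).ennreal_ofReal
      (Filter.Eventually.of_forall fun _ ↦ ENNReal.ofReal_lt_top)]
    have e : ∀ s, (ENNReal.ofReal (betaPDFReal p q s)).toReal • s ^ k =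
        beta (p + k) q / beta p q * betaPDFReal (p + k) q s := fun s ↦ by
      rw [ENNReal.toReal_ofReal (betaPDFReal_nonneg hp hq s), smul_eq_mul, key]
    rw [integral_congr_ae (Filter.Eventually.of_forall e)]
    rw [integral_const_mul, integral_betaPDFReal hpk hq, mul_one, beta, beta,
      show p + k + q = p + q + k by ring, Real.Gamma_add_natCast hp,
      Real.Gamma_add_natCast (by positivity)]
    have := (Real.Gamma_pos_of_pos hp).ne'
    have := (Real.Gamma_pos_of_pos hq).ne'
    have := (Real.Gamma_pos_of_pos (add_pos hp hq)).ne'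
    have := (ascPochhammer_pos k _ (add_pos hp hq)).ne'
    field_simp

/-- On `[1/4, 3/4]` a non-degenerate beta law dominates a multiple of Lebesgue measure. -/
theorem exists_smul_volume_le_betaLaw {p q : ℝ} (hp : 0 < p) (hq : 0 < q) :
    ∃ c : NNReal, 0 < c ∧ c • volume.restrict (Icc (1 / 4 : ℝ) (3 / 4)) ≤ betaLaw p q := by
  have hcont : ContinuousOn (betaPDFReal p q) (Icc (1 / 4 : ℝ) (3 / 4)) := by
    have : ContinuousOn (fun x : ℝ ↦ (1 / beta p q) * x ^ (p - 1) * (1 - x) ^ (q - 1))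
        (Icc (1 / 4 : ℝ) (3 / 4)) := by
      refine (continuousOn_const.mul (continuousOn_id.rpow_const ?_)).mul
        ((continuousOn_const.sub continuousOn_id).rpow_const ?_)
      · exact fun x hx ↦ Or.inl (show x ≠ 0 by linarith [hx.1])
      · exact fun x hx ↦ Or.inl (show 1 - x ≠ 0 by linarith [hx.2])
    refine this.congr fun x hx ↦ ?_
    rw [betaPDFReal, if_pos ⟨by linarith [hx.1], by linarith [hx.2]⟩]
  obtain ⟨x, hx, hmin⟩ := isCompact_Icc.exists_isMinOn ⟨1 / 4, by norm_num⟩ hcont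
  have hpos : 0 < betaPDFReal p q x :=
    betaPDFReal_pos (by linarith [hx.1]) (by linarith [hx.2]) hp hq
  refine ⟨(betaPDFReal p q x).toNNReal, by simpa using hpos, ?_⟩
  rw [betaLaw_of_pos p hq]
  refine Measure.le_iff.2 fun s hs ↦ ?_
  rw [betaMeasure, withDensity_apply _ hs, Measure.smul_apply, Measure.restrict_apply hs]
  calc (betaPDFReal p q x).toNNReal • volume (s ∩ Icc (1 / 4 : ℝ) (3 / 4))
      = ∫⁻ _ in s ∩ Icc (1 / 4 : ℝ) (3 / 4), ENNReal.ofReal (betaPDFReal p q x) := by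
        rw [lintegral_const, Measure.restrict_apply_univ]; rfl
    _ ≤ ∫⁻ y in s ∩ Icc (1 / 4 : ℝ) (3 / 4), betaPDF p q y := by
        refine setLIntegral_mono' (hs.inter measurableSet_Icc) fun y hy ↦ ?_
        exact ENNReal.ofReal_le_ofReal (hmin hy.2)
    _ ≤ ∫⁻ y in s, betaPDF p q y := lintegral_mono_set inter_subset_left

theorem betaLaw_real_Icc_pos {p q : ℝ} (hp : 0 < p) (hq : 0 ≤ q) :
    0 < (betaLaw p q).real (Icc (1 / 4 : ℝ) 1) := by
  have := isProbabilityMeasure_betaLaw hp hq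
  rw [measureReal_def, ENNReal.toReal_pos_iff]
  refine ⟨?_, measure_lt_top _ _⟩
  rcases hq.eq_or_lt with rfl | hq
  · rw [betaLaw_zero, Measure.dirac_apply' _ measurableSet_Icc]
    norm_num
  · obtain ⟨c, hc, hle⟩ := exists_smul_volume_le_betaLaw hp hq
    refine lt_of_lt_of_le ?_ (hle (Icc (1 / 4 : ℝ) 1))
    rw [Measure.smul_apply, Measure.restrict_apply measurableSet_Icc, Icc_inter_Icc,
      ENNReal.smul_def, smul_eq_mul]
    refine ENNReal.mul_pos (by exact_mod_cast hc.ne') ?_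
    norm_num [Real.volume_Icc]

/-! ### The double binomial series -/

theorem sum_antidiagonal_ascPochhammer_div_factorial {K : Type*} [Field K] [CharZero K]
    (a u v : K) (N : ℕ) :
    ∑ p ∈ Finset.HasAntidiagonal.antidiagonal N, (ascPochhammer K (p.1 + p.2)).eval a /
      ((p.1.factorial : K) * p.2.factorial) * u ^ p.1 * v ^ p.2 =
      (ascPochhammer K N).eval a / (N.factorial : K) * (u + v) ^ N := by
  rw [(Commute.all u v).add_pow', Finset.mul_sum]
  refine Finset.sum_congr rfl fun p hp ↦ ?_
  obtain rfl := Finset.HasAntidiagonal.mem_antidiagonal.1 hp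
  have h1 : (p.1.factorial : K) ≠ 0 := by exact_mod_cast p.1.factorial_ne_zero
  have h2 : (p.2.factorial : K) ≠ 0 := by exact_mod_cast p.2.factorial_ne_zero
  have h3 : ((p.1 + p.2).factorial : K) ≠ 0 := by exact_mod_cast (p.1 + p.2).factorial_ne_zero
  have hch : ((p.1 + p.2).choose p.1 : K) * p.1.factorial * p.2.factorial =
      (p.1 + p.2).factorial := by
    rw [Nat.choose_symm_add]
    exact_mod_cast Nat.add_choose_mul_factorial_mul_factorial p.1 p.2
  rw [nsmul_eq_mul, ← hch]
  have h4 : ((p.1 + p.2).choose p.1 : K) ≠ 0 := by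
    intro h; rw [h, zero_mul, zero_mul] at hch; exact h3 hch.symm
  field_simp

theorem summable_of_sum_antidiagonal_eq {T : ℕ × ℕ → ℝ} {g : ℕ → ℝ} (hT : ∀ p, 0 ≤ T p)
    (hg : ∀ N, ∑ p ∈ Finset.HasAntidiagonal.antidiagonal N, T p = g N) (hs : Summable g) :
    Summable T := by
  rw [← (Finset.HasAntidiagonal.sigmaAntidiagonalEquivProd (A := ℕ)).summable_iff]
  refine (summable_sigma_of_nonneg fun p ↦ hT _).2 ⟨fun N ↦ Summable.of_finite, ?_⟩
  refine hs.congr fun N ↦ ?_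
  rw [← hg N]
  exact (Finset.hasSum (Finset.HasAntidiagonal.antidiagonal N) T).tsum_eq.symm

theorem HasSum.sum_antidiagonal {T : ℕ × ℕ → ℂ} {z : ℂ} (h : HasSum T z) :
    HasSum (fun N ↦ ∑ p ∈ Finset.HasAntidiagonal.antidiagonal N, T p) z :=
  ((Finset.HasAntidiagonal.sigmaAntidiagonalEquivProd (A := ℕ)).hasSum_iff.2 h).sigma fun N ↦
    Finset.hasSum (Finset.HasAntidiagonal.antidiagonal N) T

/-- The double binomial series converges absolutely for `|u| + |v| < 1`. -/
theorem summable_ascPochhammer_add {s u v : ℝ} (hs : 0 ≤ s) (hu : 0 ≤ u) (hv : 0 ≤ v)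
    (huv : u + v < 1) : Summable fun p : ℕ × ℕ ↦ (ascPochhammer ℝ (p.1 + p.2)).eval s /
      ((p.1.factorial : ℝ) * p.2.factorial) * u ^ p.1 * v ^ p.2 := by
  have hasc : ∀ n, 0 ≤ (ascPochhammer ℝ n).eval s := by
    intro n
    have := norm_ascPochhammer_eval_le (s : ℂ) 0 n
    simp only [Nat.cast_zero, add_zero, Complex.norm_real, Real.norm_of_nonneg hs] at this
    exact (norm_nonneg _).trans this
  refine summable_of_sum_antidiagonal_eq (fun p ↦ ?_)
    (sum_antidiagonal_ascPochhammer_div_factorial s u v)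
    (hasSum_one_sub_rpow_neg s (by rwa [abs_of_nonneg (by positivity)])).summable
  have := hasc (p.1 + p.2)
  positivity

theorem norm_double_binomial_term_le (a u v : ℂ) (p : ℕ × ℕ) :
    ‖(ascPochhammer ℂ (p.1 + p.2)).eval a / ((p.1.factorial : ℂ) * p.2.factorial) *
      u ^ p.1 * v ^ p.2‖ ≤ (ascPochhammer ℝ (p.1 + p.2)).eval ‖a‖ /
      ((p.1.factorial : ℝ) * p.2.factorial) * ‖u‖ ^ p.1 * ‖v‖ ^ p.2 := by
  simp only [norm_mul, norm_div, norm_pow, Complex.norm_natCast]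
  gcongr
  simpa using norm_ascPochhammer_eval_le a 0 (p.1 + p.2)

/-- The double series is the binomial series of `1 - (u + v)`, with `(u + v) ^ N` expanded. -/
theorem hasSum_one_sub_sub_cpow_neg (a : ℂ) {u v : ℂ} (huv : ‖u‖ + ‖v‖ < 1) :
    HasSum (fun p : ℕ × ℕ ↦ (ascPochhammer ℂ (p.1 + p.2)).eval a /
      ((p.1.factorial : ℂ) * p.2.factorial) * u ^ p.1 * v ^ p.2) ((1 - u - v) ^ (-a)) := by
  have hsum : Summable (fun p : ℕ × ℕ ↦ (ascPochhammer ℂ (p.1 + p.2)).eval a /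
      ((p.1.factorial : ℂ) * p.2.factorial) * u ^ p.1 * v ^ p.2) :=
    Summable.of_norm_bounded
      (summable_ascPochhammer_add (norm_nonneg a) (norm_nonneg u) (norm_nonneg v) huv)
      (norm_double_binomial_term_le a u v)
  have h := hsum.hasSum.sum_antidiagonal
  simp only [sum_antidiagonal_ascPochhammer_div_factorial] at h
  have h' := hasSum_one_sub_cpow_neg a ((norm_add_le u v).trans_lt huv)
  rw [← sub_sub] at h'
  rw [← h.unique h']
  exact hsum.hasSum

theorem injective_two_mul_prod : Function.Injective fun p : ℕ × ℕ ↦ (2 * p.1, p.2) := by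
  rintro ⟨l, j⟩ ⟨l', j'⟩ h
  simp only [Prod.mk.injEq] at h ⊢
  omega

/-- The even part in `u` of the double binomial series. -/
theorem hasSum_even_part_one_sub_sub_cpow_neg (a : ℂ) {u v : ℂ} (huv : ‖u‖ + ‖v‖ < 1) :
    HasSum (fun p : ℕ × ℕ ↦ (ascPochhammer ℂ (2 * p.1 + p.2)).eval a /
      (((2 * p.1).factorial : ℂ) * p.2.factorial) * u ^ (2 * p.1) * v ^ p.2)
      (((1 + u - v) ^ (-a) + (1 - u - v) ^ (-a)) / 2) := by
  have h1 := hasSum_one_sub_sub_cpow_neg a huv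
  have h2 := hasSum_one_sub_sub_cpow_neg a (u := -u) (v := v) (by rwa [norm_neg])
  rw [sub_neg_eq_add] at h2
  have h := (h2.add h1).div_const 2
  rw [← injective_two_mul_prod.hasSum_iff] at h
  · refine h.congr_fun fun p ↦ ?_
    simp only [Function.comp, Even.neg_pow (even_two_mul p.1)]
    ring
  · rintro ⟨k, j⟩ hk
    have hodd : Odd k := by
      rw [← Nat.not_even_iff_odd]
      rintro ⟨l, rfl⟩
      exact hk ⟨(l, j), by simp [two_mul]⟩
    simp only [hodd.neg_pow]
    ring

/-! ### The quadratic transformation on coefficients -/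

theorem factorial_two_mul_eq (l : ℕ) :
    ((2 * l).factorial : ℂ) = 4 ^ l * l.factorial * (ascPochhammer ℂ l).eval (1 / 2) := by
  induction l with
  | zero => simp
  | succ l ih =>
    rw [show 2 * (l + 1) = 2 * l + 1 + 1 by ring, Nat.factorial_succ, Nat.factorial_succ,
      Nat.factorial_succ, ascPochhammer_succ_eval]
    push_cast
    rw [ih]
    ring

theorem ascPochhammer_eval_one_sub_sub (x : ℂ) (n : ℕ) :
    (ascPochhammer ℂ n).eval (1 - x - n) = (-1) ^ n * (ascPochhammer ℂ n).eval x := by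
  rw [show 1 - x - n = -(x + n - 1) by ring, ascPochhammer_eval_neg_eq_descPochhammer,
    descPochhammer_eval_eq_ascPochhammer]
  congr 2
  ring

theorem ascPochhammer_eval_ofReal_ne_zero {x : ℝ} (hx : 0 < x) (n : ℕ) :
    (ascPochhammer ℂ n).eval (x : ℂ) ≠ 0 := by
  intro h
  obtain ⟨k, -, hk⟩ := (ascPochhammer_eval_eq_zero_iff n _).1 h
  have := congrArg Complex.re hk
  simp at this
  have : (0 : ℝ) ≤ k := Nat.cast_nonneg k
  linarith

/-- The coefficient identity behind the quadratic transformation: collecting equal powers in the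
integrated double binomial series leaves a Chu-Vandermonde sum. -/
theorem sum_antidiagonal_quadratic_transformation (a : ℂ) {α β : ℝ} (hβ : 0 < β + 1)
    (n : ℕ) :
    ∑ p ∈ Finset.HasAntidiagonal.antidiagonal n,
      (ascPochhammer ℂ (2 * p.1 + p.2)).eval a / (((2 * p.1).factorial : ℂ) * p.2.factorial) *
        4 ^ p.1 * (-1) ^ p.2 *
        ((ascPochhammer ℂ (p.1 + p.2)).eval ((β + 1 : ℝ) : ℂ) /
          (ascPochhammer ℂ (p.1 + p.2)).eval ((α + 1 : ℝ) : ℂ) *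
        ((ascPochhammer ℂ p.1).eval (1 / 2) / (ascPochhammer ℂ p.1).eval ((β + 1 : ℝ) : ℂ))) =
      ordinaryHypergeometricCoefficient a (a - β) ((α + 1 : ℝ) : ℂ) n := by
  have hhalf : ∀ l, (ascPochhammer ℂ l).eval (1 / 2 : ℂ) ≠ 0 := fun l ↦ by
    have := ascPochhammer_eval_ofReal_ne_zero (x := 1 / 2) (by norm_num) l
    push_cast at this
    exact this
  have hb := ascPochhammer_eval_ofReal_ne_zero hβ
  have hv := sum_ascPochhammer_vandermonde n ((β + 1 : ℝ) : ℂ) (a + n)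
  rw [show ((β + 1 : ℝ) : ℂ) - (a + n) = 1 - (a - β) - n by push_cast; ring,
    ascPochhammer_eval_one_sub_sub] at hv
  have hn : (n.factorial : ℂ) ≠ 0 := by exact_mod_cast n.factorial_ne_zero
  have hsq : ((-1 : ℂ) ^ n) * (-1) ^ n = 1 := by rw [← mul_pow]; simp
  have hv' : (ascPochhammer ℂ n).eval (a - β) = (-1) ^ n * ∑ l ∈ Finset.range (n + 1),
      (n.choose l : ℂ) * (-1) ^ l * (ascPochhammer ℂ l).eval (a + n) *
      (ascPochhammer ℂ (n - l)).eval (((β + 1 : ℝ) : ℂ) + l) := by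
    rw [hv, ← mul_assoc, hsq, one_mul]
  rw [ordinaryHypergeometricCoefficient, hv', Finset.Nat.sum_antidiagonal_eq_sum_range_succ_mk,
    Finset.mul_sum, Finset.mul_sum, Finset.sum_mul]
  refine Finset.sum_congr rfl fun l hl ↦ ?_
  have hl' : l ≤ n := by simpa [Nat.lt_succ_iff] using hl
  obtain ⟨j, rfl⟩ := Nat.exists_eq_add_of_le hl'
  have hl0 : (l.factorial : ℂ) ≠ 0 := by exact_mod_cast l.factorial_ne_zero
  have hj0 : (j.factorial : ℂ) ≠ 0 := by exact_mod_cast j.factorial_ne_zero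
  have hch' : ((l + j).choose l : ℂ) = (l + j).factorial / (l.factorial * j.factorial) := by
    rw [eq_div_iff (mul_ne_zero hl0 hj0), Nat.choose_symm_add, ← mul_assoc]
    exact_mod_cast Nat.add_choose_mul_factorial_mul_factorial l j
  have hll : ((-1 : ℂ) ^ l) * (-1) ^ l = 1 := by rw [← mul_pow]; simp
  have h4 : (4 : ℂ) ^ l ≠ 0 := pow_ne_zero _ (by norm_num)
  rw [Nat.add_sub_cancel_left, show 2 * l + j = (l + j) + l by ring, ascPochhammer_eval_add a,
    ascPochhammer_eval_add ((β + 1 : ℝ) : ℂ), factorial_two_mul_eq, hch', pow_add]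
  have := hhalf l
  have := hb l
  generalize (ascPochhammer ℂ l).eval (1 / 2 : ℂ) = h at *
  generalize (ascPochhammer ℂ l).eval ((β + 1 : ℝ) : ℂ) = b at *
  by_cases hA : (ascPochhammer ℂ (l + j)).eval ((α + 1 : ℝ) : ℂ) = 0
  · rw [hA]; simp
  field_simp
  linear_combination (-((ascPochhammer ℂ (l + j)).eval a * (ascPochhammer ℂ l).eval (a + ↑(l + j)) *
    (ascPochhammer ℂ j).eval (((β + 1 : ℝ) : ℂ) + l))) * hll

/-! ### The integral formula for small arguments -/

/-- The product of the two beta laws over which the Jacobi functions with parameters `α ≥ β` are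
averaged. In the coordinates `r ∈ [0, 1]`, `ψ ∈ [0, π]` of the classical integral formula the
points of its domain are `(r ^ 2, cos ψ ^ 2)`. -/
noncomputable def jacobiMeasure (α β : ℝ) : Measure (ℝ × ℝ) :=
  (betaLaw (β + 1) (α - β)).prod (betaLaw (1 / 2) (β + 1 / 2))

theorem isProbabilityMeasure_jacobiMeasure {α β : ℝ} (hβ : -1 / 2 ≤ β) (hβα : β ≤ α) :
    IsProbabilityMeasure (jacobiMeasure α β) := by
  have := isProbabilityMeasure_betaLaw (p := β + 1) (q := α - β) (by linarith) (by linarith)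
  have := isProbabilityMeasure_betaLaw (p := 1 / 2) (q := β + 1 / 2) (by norm_num) (by linarith)
  unfold jacobiMeasure
  infer_instance

theorem ae_jacobiMeasure_mem {α β : ℝ} (hβ : -1 / 2 ≤ β) (hβα : β ≤ α) :
    ∀ᵐ p ∂(jacobiMeasure α β), p.1 ∈ Icc (0 : ℝ) 1 ∧ p.2 ∈ Icc (0 : ℝ) 1 := by
  have := isProbabilityMeasure_betaLaw (p := β + 1) (q := α - β) (by linarith) (by linarith)
  have := isProbabilityMeasure_betaLaw (p := 1 / 2) (q := β + 1 / 2) (by norm_num) (by linarith)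
  have h1 := ae_betaLaw_mem_Icc (β + 1) (q := α - β) (by linarith)
  have h2 := ae_betaLaw_mem_Icc (1 / 2) (q := β + 1 / 2) (by linarith)
  exact (Measure.quasiMeasurePreserving_fst.ae h1).and (Measure.quasiMeasurePreserving_snd.ae h2)

theorem integral_pow_mul_pow_jacobiMeasure {α β : ℝ} (hβ : -1 / 2 ≤ β) (hβα : β ≤ α) (m l : ℕ) :
    ∫ p, p.1 ^ m * p.2 ^ l ∂(jacobiMeasure α β) =
      (ascPochhammer ℝ m).eval (β + 1) / (ascPochhammer ℝ m).eval (α + 1) *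
      ((ascPochhammer ℝ l).eval (1 / 2) / (ascPochhammer ℝ l).eval (β + 1)) := by
  have := isProbabilityMeasure_betaLaw (p := β + 1) (q := α - β) (by linarith) (by linarith)
  have := isProbabilityMeasure_betaLaw (p := 1 / 2) (q := β + 1 / 2) (by norm_num) (by linarith)
  rw [jacobiMeasure, integral_prod_mul (fun s ↦ s ^ m) (fun s ↦ s ^ l),
    integral_pow_betaLaw (by linarith) (by linarith),
    integral_pow_betaLaw (by norm_num) (by linarith), show β + 1 + (α - β) = α + 1 by ring,
    show 1 / 2 + (β + 1 / 2) = β + 1 by ring]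

/-- The squared distance `1 + 2 w √(p₁ p₂) + w² p₁`, that is `|1 + w r e^{iψ}|²` for real `w`, with
`p₁ = r ^ 2` and `√p₂ = cos ψ`; the other sign of `cos ψ` is obtained from `-w`. -/
noncomputable def distSq (w : ℂ) (p : ℝ × ℝ) : ℂ :=
  1 + 2 * w * (√(p.1 * p.2) : ℝ) + w ^ 2 * p.1

theorem ofReal_ascPochhammer_eval (x : ℝ) (n : ℕ) : (((ascPochhammer ℝ n).eval x : ℝ) : ℂ) =
    (ascPochhammer ℂ n).eval (x : ℂ) := by
  induction n with
  | zero => simp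
  | succ n ih => rw [ascPochhammer_succ_eval, ascPochhammer_succ_eval]; push_cast; rw [ih]

/-- Termwise integration of an absolutely convergent double series in `p₁ p₂` and `p₁`. -/
theorem hasSum_integral_jacobiMeasure {α β : ℝ} (hβ : -1 / 2 ≤ β) (hβα : β ≤ α)
    {c : ℕ × ℕ → ℂ} {b : ℕ × ℕ → ℝ} (hcb : ∀ q, ‖c q‖ ≤ b q) (hb : Summable b)
    {G : ℝ × ℝ → ℂ} (hG : ∀ p : ℝ × ℝ, p.1 ∈ Icc (0 : ℝ) 1 → p.2 ∈ Icc (0 : ℝ) 1 →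
      HasSum (fun q : ℕ × ℕ ↦ c q * ((p.1 ^ (q.1 + q.2) * p.2 ^ q.1 : ℝ) : ℂ)) (G p)) :
    HasSum (fun q : ℕ × ℕ ↦ c q *
      ((ascPochhammer ℂ (q.1 + q.2)).eval ((β + 1 : ℝ) : ℂ) /
          (ascPochhammer ℂ (q.1 + q.2)).eval ((α + 1 : ℝ) : ℂ) *
        ((ascPochhammer ℂ q.1).eval (1 / 2) / (ascPochhammer ℂ q.1).eval ((β + 1 : ℝ) : ℂ))))
      (∫ p, G p ∂(jacobiMeasure α β)) := by
  have := isProbabilityMeasure_jacobiMeasure hβ hβα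
  have hF : ∀ q : ℕ × ℕ,
      ∫ p, c q * ((p.1 ^ (q.1 + q.2) * p.2 ^ q.1 : ℝ) : ℂ) ∂(jacobiMeasure α β) = c q *
        ((ascPochhammer ℂ (q.1 + q.2)).eval ((β + 1 : ℝ) : ℂ) /
          (ascPochhammer ℂ (q.1 + q.2)).eval ((α + 1 : ℝ) : ℂ) *
        ((ascPochhammer ℂ q.1).eval (1 / 2) /
          (ascPochhammer ℂ q.1).eval ((β + 1 : ℝ) : ℂ))) := by
    intro q
    rw [integral_const_mul, integral_complex_ofReal, integral_pow_mul_pow_jacobiMeasure hβ hβα,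
      Complex.ofReal_mul, Complex.ofReal_div, Complex.ofReal_div]
    simp only [ofReal_ascPochhammer_eval]
    norm_num
  simp only [← hF]
  refine hasSum_integral_of_dominated_convergence (fun q _ ↦ b q) (fun q ↦ ?_) (fun q ↦ ?_)
    (Filter.Eventually.of_forall fun _ ↦ hb) (integrable_const _) ?_
  · exact Measurable.aestronglyMeasurable (by fun_prop)
  · filter_upwards [ae_jacobiMeasure_mem hβ hβα] with p hp
    obtain ⟨⟨h1, h1'⟩, h2, h2'⟩ := hp
    have e : ‖((p.1 ^ (q.1 + q.2) * p.2 ^ q.1 : ℝ) : ℂ)‖ ≤ 1 := by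
      rw [Complex.norm_real, Real.norm_of_nonneg (by positivity)]
      exact mul_le_one₀ (pow_le_one₀ h1 h1') (by positivity) (pow_le_one₀ h2 h2')
    rw [norm_mul]
    exact (mul_le_of_le_one_right (norm_nonneg _) e).trans (hcb q)
  · filter_upwards [ae_jacobiMeasure_mem hβ hβα] with p hp
    exact hG p hp.1 hp.2

/-- Expansion of the average of `distSq w p ^ (-a)` over the sign of `w`. -/
theorem hasSum_distSq_cpow_neg (a : ℂ) {w : ℂ} (hw : ‖w‖ < 1 / 3) {p : ℝ × ℝ}
    (hp1 : p.1 ∈ Icc (0 : ℝ) 1) (hp2 : p.2 ∈ Icc (0 : ℝ) 1) :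
    HasSum (fun q : ℕ × ℕ ↦ (ascPochhammer ℂ (2 * q.1 + q.2)).eval a /
      (((2 * q.1).factorial : ℂ) * q.2.factorial) * (2 * w) ^ (2 * q.1) * (-w ^ 2) ^ q.2 *
      ((p.1 ^ (q.1 + q.2) * p.2 ^ q.1 : ℝ) : ℂ))
      ((distSq w p ^ (-a) + distSq (-w) p ^ (-a)) / 2) := by
  obtain ⟨h1, h1'⟩ := hp1
  obtain ⟨h2, h2'⟩ := hp2
  have hs0 := Real.sqrt_nonneg (p.1 * p.2)
  have hs1 : √(p.1 * p.2) ≤ 1 := Real.sqrt_le_one.2 (mul_le_one₀ h1' h2 h2')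
  have hs : (((√(p.1 * p.2) : ℝ) : ℂ)) ^ 2 = (p.1 : ℂ) * p.2 := by
    rw [← Complex.ofReal_pow, Real.sq_sqrt (mul_nonneg h1 h2), Complex.ofReal_mul]
  have h := hasSum_even_part_one_sub_sub_cpow_neg a
    (u := 2 * w * (√(p.1 * p.2) : ℝ)) (v := -w ^ 2 * p.1) (by
      simp only [norm_mul, norm_neg, norm_pow, Complex.norm_real, Real.norm_of_nonneg hs0,
        Real.norm_of_nonneg h1, Complex.norm_ofNat]
      have : 2 * ‖w‖ * √(p.1 * p.2) ≤ 2 * ‖w‖ * 1 := by gcongr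
      have : ‖w‖ ^ 2 * p.1 ≤ ‖w‖ ^ 2 * 1 := by gcongr
      nlinarith [norm_nonneg w])
  have e1 : 1 + 2 * w * (√(p.1 * p.2) : ℝ) - -w ^ 2 * p.1 = distSq w p := by
    rw [distSq]; ring
  have e2 : 1 - 2 * w * (√(p.1 * p.2) : ℝ) - -w ^ 2 * p.1 = distSq (-w) p := by
    rw [distSq]; ring
  rw [e1, e2] at h
  refine h.congr_fun fun q ↦ ?_
  have e3 : (2 * w * ((√(p.1 * p.2) : ℝ) : ℂ)) ^ (2 * q.1) =
      (2 * w) ^ (2 * q.1) * ((p.1 : ℂ) ^ q.1 * (p.2 : ℂ) ^ q.1) := by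
    rw [mul_pow (2 * w), pow_mul ((√(p.1 * p.2) : ℝ) : ℂ), hs, mul_pow (p.1 : ℂ)]
  rw [e3, mul_pow (-w ^ 2)]
  push_cast
  rw [pow_add]
  ring

/-- For small `w` the average of `|1 ± w r e^{iψ}|^{-2a}` is a hypergeometric function of `w²`. -/
theorem integral_distSq_of_norm_lt (a : ℂ) {α β : ℝ} (hβ : -1 / 2 ≤ β) (hβα : β ≤ α) {w : ℂ}
    (hw : ‖w‖ < 1 / 3) :
    ∫ p, (distSq w p ^ (-a) + distSq (-w) p ^ (-a)) / 2 ∂(jacobiMeasure α β) =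
      ordinaryHypergeometric a (a - β) ((α + 1 : ℝ) : ℂ) (w ^ 2) := by
  have hb := (summable_ascPochhammer_add (norm_nonneg a) (u := ‖2 * w‖) (v := ‖-w ^ 2‖)
      (by positivity) (by positivity) (by
        simp only [norm_mul, norm_neg, norm_pow, Complex.norm_ofNat]
        nlinarith [norm_nonneg w])).comp_injective injective_two_mul_prod
  have key := hasSum_integral_jacobiMeasure hβ hβα
    (fun q ↦ norm_double_binomial_term_le a (2 * w) (-w ^ 2) (2 * q.1, q.2)) hb
    (fun p hp1 hp2 ↦ hasSum_distSq_cpow_neg a hw hp1 hp2)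
  rw [ordinaryHypergeometric, ordinaryHypergeometric_sum_eq, ← key.sum_antidiagonal.tsum_eq]
  refine tsum_congr fun n ↦ ?_
  have e := sum_antidiagonal_quadratic_transformation a (α := α) (β := β) (by linarith) n
  rw [ordinaryHypergeometricCoefficient] at e
  rw [← e, smul_eq_mul, Finset.sum_mul]
  refine Finset.sum_congr rfl fun q hq ↦ ?_
  obtain rfl := Finset.HasAntidiagonal.mem_antidiagonal.1 hq
  have e4 : (2 * w) ^ (2 * q.1) = 4 ^ q.1 * (w ^ 2) ^ q.1 := by
    rw [pow_mul, mul_pow, mul_pow]; norm_num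
  rw [e4, neg_pow (w ^ 2), pow_add (w ^ 2)]
  ring

/-! ### Analytic continuation to the unit disc -/

/-- As `1 + 2 w X + w² R` avoids the branch cut in the whole unit disc, its powers are holomorphic
there. -/
theorem distSq_mem_slitPlane {w : ℂ} (hw : ‖w‖ < 1) {p : ℝ × ℝ} (hp1 : p.1 ∈ Icc (0 : ℝ) 1)
    (hp2 : p.2 ∈ Icc (0 : ℝ) 1) : distSq w p ∈ Complex.slitPlane := by
  obtain ⟨h1, h1'⟩ := hp1
  obtain ⟨h2, h2'⟩ := hp2
  have hX0 := Real.sqrt_nonneg (p.1 * p.2)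
  have hX : √(p.1 * p.2) ^ 2 = p.1 * p.2 := Real.sq_sqrt (mul_nonneg h1 h2)
  have hX1 : √(p.1 * p.2) ≤ 1 := Real.sqrt_le_one.2 (mul_le_one₀ h1' h2 h2')
  have hXR : √(p.1 * p.2) ^ 2 ≤ p.1 := by
    rw [hX]; exact mul_le_of_le_one_right h1 h2'
  have hn : w.re ^ 2 + w.im ^ 2 < 1 := by
    have := Complex.normSq_eq_norm_sq w
    rw [Complex.normSq_apply] at this
    nlinarith [norm_nonneg w]
  have hre : (distSq w p).re = 1 + 2 * w.re * √(p.1 * p.2) + (w.re ^ 2 - w.im ^ 2) * p.1 := by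
    simp [distSq, pow_two]
  have him : (distSq w p).im = 2 * w.im * (√(p.1 * p.2) + w.re * p.1) := by
    simp [distSq, pow_two]; ring
  rw [Complex.mem_slitPlane_iff]
  by_contra! h
  rw [hre, him] at h
  generalize √(p.1 * p.2) = X at *
  obtain ⟨h, h0⟩ := h
  rcases mul_eq_zero.1 h0 with h0 | h0
  · -- for real `w` the value is at least `(1 + w X) ^ 2`
    have hv : w.im = 0 := by linarith
    rw [hv] at h hn
    have hlt : 0 < 1 + w.re * X := by nlinarith
    have : w.re ^ 2 * X ^ 2 ≤ w.re ^ 2 * p.1 := by gcongr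
    nlinarith
  · -- otherwise a real value equals `1 - |w| ^ 2 p₁`
    have hX' : X = -(w.re * p.1) := by linarith
    rw [hX'] at h
    nlinarith

theorem hasDerivAt_distSq (w : ℂ) (p : ℝ × ℝ) :
    HasDerivAt (fun w ↦ distSq w p) (2 * (√(p.1 * p.2) : ℝ) + 2 * w * p.1) w := by
  have h1 : HasDerivAt (fun w : ℂ ↦ 2 * w * (√(p.1 * p.2) : ℝ)) (2 * 1 * (√(p.1 * p.2) : ℝ)) w :=
    ((hasDerivAt_id w).const_mul 2).mul_const _
  have h2 : HasDerivAt (fun w : ℂ ↦ w ^ 2 * (p.1 : ℂ)) (2 * w * p.1) w := by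
    simpa using (hasDerivAt_pow 2 w).mul_const (p.1 : ℂ)
  exact ((h1.const_add 1).fun_add h2).congr_deriv (by ring)

theorem continuous_distSq : Continuous fun q : ℂ × ℝ × ℝ ↦ distSq q.1 q.2 := by
  unfold distSq; fun_prop

theorem measurable_distSq_cpow (a w : ℂ) : Measurable fun p ↦ distSq w p ^ a := by
  have : Measurable fun p ↦ distSq w p := by unfold distSq; fun_prop
  fun_prop

/-- Local boundedness in `w`, uniform in `p`, from compactness; it provides the domination for
differentiating under the integral sign. -/
theorem exists_bound_distSq_cpow (a : ℂ) {w : ℂ} (hw : ‖w‖ < 1) : ∃ ε > 0, ∃ C : ℝ,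
    ∀ w' ∈ Metric.ball w ε, ‖w'‖ < 1 ∧ ∀ p : ℝ × ℝ, p.1 ∈ Icc (0 : ℝ) 1 → p.2 ∈ Icc (0 : ℝ) 1 →
      ‖distSq w' p ^ a‖ ≤ C := by
  obtain ⟨r, hwr, hr1⟩ := exists_between hw
  have hK : IsCompact (Metric.closedBall (0 : ℂ) r ×ˢ (Icc (0 : ℝ) 1 ×ˢ Icc (0 : ℝ) 1)) :=
    (isCompact_closedBall _ _).prod (isCompact_Icc.prod isCompact_Icc)
  have hc : ContinuousOn (fun q : ℂ × ℝ × ℝ ↦ distSq q.1 q.2 ^ a)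
      (Metric.closedBall (0 : ℂ) r ×ˢ (Icc (0 : ℝ) 1 ×ˢ Icc (0 : ℝ) 1)) := by
    refine continuous_distSq.continuousOn.cpow continuousOn_const fun q hq ↦ ?_
    have : ‖q.1‖ ≤ r := by simpa using hq.1
    exact distSq_mem_slitPlane (this.trans_lt hr1) hq.2.1 hq.2.2
  obtain ⟨C, hC⟩ := hK.exists_bound_of_continuousOn hc
  refine ⟨r - ‖w‖, by linarith, C, fun w' hw' ↦ ?_⟩
  have hwr' : ‖w'‖ < r := by
    have h1 : ‖w' - w‖ < r - ‖w‖ := by simpa [dist_eq_norm] using hw'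
    have h2 := norm_add_le (w' - w) w
    rw [sub_add_cancel] at h2
    linarith
  exact ⟨hwr'.trans hr1, fun p hp1 hp2 ↦ hC (w', p) ⟨by simpa using hwr'.le, hp1, hp2⟩⟩

theorem integrable_distSq_cpow (a : ℂ) {α β : ℝ} (hβ : -1 / 2 ≤ β) (hβα : β ≤ α) {w : ℂ}
    (hw : ‖w‖ < 1) : Integrable (fun p ↦ distSq w p ^ a) (jacobiMeasure α β) := by
  have := isProbabilityMeasure_jacobiMeasure hβ hβα
  obtain ⟨ε, hε, C, hC⟩ := exists_bound_distSq_cpow a hw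
  refine Integrable.of_bound (measurable_distSq_cpow a w).aestronglyMeasurable C ?_
  filter_upwards [ae_jacobiMeasure_mem hβ hβα] with p hp
  exact (hC w (Metric.mem_ball_self hε)).2 p hp.1 hp.2

theorem differentiableOn_integral_distSq_cpow (a : ℂ) {α β : ℝ} (hβ : -1 / 2 ≤ β) (hβα : β ≤ α) :
    DifferentiableOn ℂ (fun w ↦ ∫ p, distSq w p ^ a ∂(jacobiMeasure α β)) (Metric.ball 0 1) := by
  have := isProbabilityMeasure_jacobiMeasure hβ hβα
  intro w hw
  have hw1 : ‖w‖ < 1 := by simpa using hw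
  obtain ⟨ε, hε, C, hC⟩ := exists_bound_distSq_cpow (a - 1) hw1
  have hmem : ∀ᶠ w' in nhds w, w' ∈ Metric.ball w ε := Metric.ball_mem_nhds w hε
  refine (hasDerivAt_integral_of_dominated_loc_of_deriv_le (Metric.ball_mem_nhds w hε)
    (F' := fun w p ↦ a * distSq w p ^ (a - 1) * (2 * (√(p.1 * p.2) : ℝ) + 2 * w * p.1))
    (bound := fun _ ↦ ‖a‖ * C * 4)
    (hmem.mono fun w' _ ↦ (measurable_distSq_cpow a w').aestronglyMeasurable)
    (integrable_distSq_cpow a hβ hβα hw1) ?_ ?_ (integrable_const _)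
    ?_).2.differentiableAt.differentiableWithinAt
  · have := measurable_distSq_cpow (a - 1) w
    exact Measurable.aestronglyMeasurable (by fun_prop)
  · filter_upwards [ae_jacobiMeasure_mem hβ hβα] with p hp w' hw'
    obtain ⟨⟨h1, h1'⟩, h2, h2'⟩ := hp
    have hb := (hC w' hw').2 p ⟨h1, h1'⟩ ⟨h2, h2'⟩
    have hX1 : √(p.1 * p.2) ≤ 1 := Real.sqrt_le_one.2 (mul_le_one₀ h1' h2 h2')
    have hd : ‖(2 * (√(p.1 * p.2) : ℝ) + 2 * w' * p.1 : ℂ)‖ ≤ 4 := by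
      refine (norm_add_le _ _).trans ?_
      simp only [norm_mul, Complex.norm_real, Real.norm_of_nonneg (Real.sqrt_nonneg _),
        Real.norm_of_nonneg h1, Complex.norm_ofNat]
      have : ‖w'‖ * p.1 ≤ 1 := mul_le_one₀ (hC w' hw').1.le h1 h1'
      linarith
    rw [norm_mul, norm_mul]
    have hC0 : 0 ≤ C := (norm_nonneg _).trans hb
    gcongr
  · filter_upwards [ae_jacobiMeasure_mem hβ hβα] with p hp w' hw'
    exact (hasDerivAt_distSq w' p).cpow_const (distSq_mem_slitPlane (hC w' hw').1 hp.1 hp.2)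

theorem analyticOnNhd_ordinaryHypergeometric (a b c : ℂ) :
    AnalyticOnNhd ℂ (ordinaryHypergeometric a b c : ℂ → ℂ) (Metric.ball 0 1) := by
  intro z hz
  have hr := one_le_radius_ordinaryHypergeometricSeries a b c
  refine ((ordinaryHypergeometricSeries ℂ a b c).hasFPowerSeriesOnBall
    (lt_of_lt_of_le one_pos hr)).analyticAt_of_mem (Metric.eball_subset_eball hr ?_)
  simpa [Metric.mem_eball, edist_zero_right, ← ofReal_norm] using hz

/-- The integral formula on the whole unit disc, by analytic continuation from small `w`. -/
theorem integral_distSq (a : ℂ) {α β : ℝ} (hβ : -1 / 2 ≤ β) (hβα : β ≤ α) {w : ℂ}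
    (hw : ‖w‖ < 1) :
    ∫ p, (distSq w p ^ (-a) + distSq (-w) p ^ (-a)) / 2 ∂(jacobiMeasure α β) =
      ordinaryHypergeometric a (a - β) ((α + 1 : ℝ) : ℂ) (w ^ 2) := by
  set H : ℂ → ℂ := fun w ↦ ∫ p, distSq w p ^ (-a) ∂(jacobiMeasure α β) with hH
  have hsplit : ∀ w : ℂ, ‖w‖ < 1 →
      ∫ p, (distSq w p ^ (-a) + distSq (-w) p ^ (-a)) / 2 ∂(jacobiMeasure α β) =
        (H w + H (-w)) / 2 := fun w hw ↦ by
    rw [integral_div, integral_add (integrable_distSq_cpow _ hβ hβα hw)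
      (integrable_distSq_cpow _ hβ hβα (by rwa [norm_neg]))]
  have hHd := differentiableOn_integral_distSq_cpow (-a) hβ hβα
  have hneg : MapsTo (fun w : ℂ ↦ -w) (Metric.ball 0 1) (Metric.ball 0 1) := fun w hw ↦ by
    simpa using hw
  have hsq : MapsTo (fun w : ℂ ↦ w ^ 2) (Metric.ball 0 1) (Metric.ball 0 1) := fun w hw ↦ by
    have : ‖w‖ < 1 := by simpa using hw
    simpa using pow_lt_one₀ (norm_nonneg w) this two_ne_zero
  have hleft : DifferentiableOn ℂ (fun w ↦ (H w + H (-w)) / 2) (Metric.ball 0 1) :=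
    (hHd.add (hHd.comp differentiable_neg.differentiableOn hneg)).div_const 2
  have hright : DifferentiableOn ℂ
      (fun w : ℂ ↦ ordinaryHypergeometric a (a - β) ((α + 1 : ℝ) : ℂ) (w ^ 2)) (Metric.ball 0 1) :=
    (analyticOnNhd_ordinaryHypergeometric a (a - β) _).differentiableOn.comp
      (differentiable_pow (𝕜 := ℂ) 2).differentiableOn hsq
  have hloc : (fun w ↦ (H w + H (-w)) / 2) =ᶠ[nhds 0]
      fun w ↦ ordinaryHypergeometric a (a - β) ((α + 1 : ℝ) : ℂ) (w ^ 2) := by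
    filter_upwards [Metric.ball_mem_nhds (0 : ℂ) (by norm_num : (0 : ℝ) < 1 / 3)] with w hw
    have hw3 : ‖w‖ < 1 / 3 := by simpa using hw
    rw [← hsplit w (by linarith), integral_distSq_of_norm_lt a hβ hβα hw3]
  rw [hsplit w hw]
  exact (hleft.analyticOnNhd Metric.isOpen_ball).eqOn_of_preconnected_of_eventuallyEq
    (hright.analyticOnNhd Metric.isOpen_ball) (convex_ball 0 1).isPreconnected
    (Metric.mem_ball_self one_pos) hloc (by simpa using hw)

/-! ### The integral formula for Jacobi functions -/

/-- The logarithm of `|cosh t + r e^{iψ} sinh t|`, with `p₁ = r ^ 2` and `√p₂ = cos ψ`. -/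
noncomputable def logDist (t : ℝ) (p : ℝ × ℝ) : ℝ :=
  Real.log (Real.cosh t ^ 2 + 2 * √(p.1 * p.2) * (Real.sinh t * Real.cosh t) +
    Real.sinh t ^ 2 * p.1) / 2

theorem logDist_arg_eq (t : ℝ) (p : ℝ × ℝ) :
    ((Real.cosh t ^ 2 + 2 * √(p.1 * p.2) * (Real.sinh t * Real.cosh t) +
    Real.sinh t ^ 2 * p.1 : ℝ) : ℂ) = ((Real.cosh t ^ 2 : ℝ) : ℂ) * distSq (Real.tanh t : ℝ) p := by
  have : (Real.cosh t : ℂ) ≠ 0 := by exact_mod_cast (Real.cosh_pos t).ne'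
  rw [distSq, Real.tanh_eq_sinh_div_cosh]
  push_cast [-Complex.ofReal_cosh, -Complex.ofReal_sinh]
  field_simp

/-- The triangle inequality `|cosh t + r e^{iψ} sinh t| ≥ cosh t - |sinh t|`, squared. -/
theorem logDist_arg_lower (t : ℝ) {p : ℝ × ℝ} (hp1 : p.1 ∈ Icc (0 : ℝ) 1)
    (hp2 : p.2 ∈ Icc (0 : ℝ) 1) : Real.exp (-|t|) ^ 2 ≤
    Real.cosh t ^ 2 + 2 * √(p.1 * p.2) * (Real.sinh t * Real.cosh t) + Real.sinh t ^ 2 * p.1 := by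
  have hK := Real.cosh_pos t
  have hr0 := Real.sqrt_nonneg p.1
  have hr1 : √p.1 ≤ 1 := Real.sqrt_le_one.2 hp1.2
  have hr2 : √p.1 ^ 2 = p.1 := Real.sq_sqrt hp1.1
  have hX0 := Real.sqrt_nonneg (p.1 * p.2)
  have hX : √(p.1 * p.2) ≤ √p.1 :=
    Real.sqrt_le_sqrt (mul_le_of_le_one_right hp1.1 hp2.2)
  have hs0 := abs_nonneg (Real.sinh t)
  have hsq := sq_abs (Real.sinh t)
  have hlt : |Real.sinh t| ≤ Real.cosh t := by
    rw [Real.abs_sinh, ← Real.cosh_abs]; exact (Real.sinh_lt_cosh _).le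
  rw [← Real.cosh_sub_sinh, Real.cosh_abs, ← Real.abs_sinh]
  have h1 : √(p.1 * p.2) * (|Real.sinh t| * Real.cosh t) ≤
      √p.1 * (|Real.sinh t| * Real.cosh t) := by gcongr
  have h2 : √(p.1 * p.2) * (-|Real.sinh t| * Real.cosh t) ≤
      √(p.1 * p.2) * (Real.sinh t * Real.cosh t) := by gcongr; exact neg_abs_le _
  have h3 : √p.1 * |Real.sinh t| ≤ |Real.sinh t| := mul_le_of_le_one_left hs0 hr1
  calc (Real.cosh t - |Real.sinh t|) ^ 2 ≤ (Real.cosh t - √p.1 * |Real.sinh t|) ^ 2 :=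
        pow_le_pow_left₀ (by linarith) (by linarith) 2
    _ = Real.cosh t ^ 2 - 2 * (√p.1 * (|Real.sinh t| * Real.cosh t)) +
        Real.sinh t ^ 2 * p.1 := by rw [sub_sq, mul_pow, hr2, hsq]; ring
    _ ≤ _ := by linarith

/-- The triangle inequality `|cosh t + r e^{iψ} sinh t| ≤ cosh t + |sinh t|`, squared. -/
theorem logDist_arg_upper (t : ℝ) {p : ℝ × ℝ} (hp1 : p.1 ∈ Icc (0 : ℝ) 1)
    (hp2 : p.2 ∈ Icc (0 : ℝ) 1) :
    Real.cosh t ^ 2 + 2 * √(p.1 * p.2) * (Real.sinh t * Real.cosh t) + Real.sinh t ^ 2 * p.1 ≤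
    Real.exp |t| ^ 2 := by
  have hK := Real.cosh_pos t
  have hX0 := Real.sqrt_nonneg (p.1 * p.2)
  have hX1 : √(p.1 * p.2) ≤ 1 := Real.sqrt_le_one.2 (mul_le_one₀ hp1.2 hp2.1 hp2.2)
  have hsq := sq_abs (Real.sinh t)
  rw [← Real.cosh_add_sinh, Real.cosh_abs, ← Real.abs_sinh]
  have h1 : √(p.1 * p.2) * (Real.sinh t * Real.cosh t) ≤
      √(p.1 * p.2) * (|Real.sinh t| * Real.cosh t) := by gcongr; exact le_abs_self _
  have h2 : √(p.1 * p.2) * (|Real.sinh t| * Real.cosh t) ≤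
      1 * (|Real.sinh t| * Real.cosh t) := by gcongr
  have h3 : Real.sinh t ^ 2 * p.1 ≤ Real.sinh t ^ 2 * 1 := by gcongr; exact hp1.2
  rw [add_sq, hsq]
  linarith

theorem abs_logDist_le (t : ℝ) {p : ℝ × ℝ} (hp1 : p.1 ∈ Icc (0 : ℝ) 1)
    (hp2 : p.2 ∈ Icc (0 : ℝ) 1) : |logDist t p| ≤ |t| := by
  have h1 := logDist_arg_lower t hp1 hp2
  have h2 := logDist_arg_upper t hp1 hp2
  have h0 : 0 < Real.exp (-|t|) ^ 2 := by positivity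
  have h3 := Real.log_le_log h0 h1
  have h4 := Real.log_le_log (h0.trans_le h1) h2
  rw [Real.log_pow, Real.log_exp] at h3 h4
  rw [logDist, abs_le]
  push_cast at h3 h4
  constructor <;> linarith

theorem measurable_logDist (t : ℝ) : Measurable (logDist t) := by
  unfold logDist; fun_prop

theorem cosh_sq_cpow_mul_distSq_cpow (a : ℂ) (t : ℝ) {p : ℝ × ℝ} (hp1 : p.1 ∈ Icc (0 : ℝ) 1)
    (hp2 : p.2 ∈ Icc (0 : ℝ) 1) :
    ((Real.cosh t ^ 2 : ℝ) : ℂ) ^ (-a) * distSq (Real.tanh t : ℝ) p ^ (-a) =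
      Complex.exp (-(2 * a) * logDist t p) := by
  have hpos := (by positivity : 0 < Real.exp (-|t|) ^ 2).trans_le (logDist_arg_lower t hp1 hp2)
  have hc : 0 < Real.cosh t ^ 2 := by have := Real.cosh_pos t; positivity
  have hD : distSq (Real.tanh t : ℝ) p =
      ((1 + 2 * Real.tanh t * √(p.1 * p.2) + Real.tanh t ^ 2 * p.1 : ℝ) : ℂ) := by
    rw [distSq]; push_cast; ring
  have hDpos : 0 < 1 + 2 * Real.tanh t * √(p.1 * p.2) + Real.tanh t ^ 2 * p.1 := by
    have h := logDist_arg_eq t p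
    rw [hD] at h
    have h' := Complex.ofReal_injective (h.trans (Complex.ofReal_mul _ _).symm)
    rw [h'] at hpos
    exact pos_of_mul_pos_right hpos hc.le
  rw [hD, ← Complex.mul_cpow_ofReal_nonneg hc.le hDpos.le, ← hD, ← logDist_arg_eq,
    Complex.cpow_def_of_ne_zero (by exact_mod_cast hpos.ne'), ← Complex.ofReal_log hpos.le, logDist]
  congr 1
  push_cast
  ring

/-- Koornwinder's integral formula for the Jacobi functions. -/
theorem jacobiFunction_eq_integral {α β : ℝ} (hβ : -1 / 2 ≤ β) (hβα : β ≤ α) (l : ℂ) (t : ℝ) :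
    jacobiFunction α β l t = ∫ p, (Complex.exp (-(jacobiRho α β + Complex.I * l) * logDist t p) +
      Complex.exp (-(jacobiRho α β + Complex.I * l) * logDist (-t) p)) / 2
        ∂(jacobiMeasure α β) := by
  have hcosh : (Real.cosh t : ℂ) ^ 2 = 1 + (Real.sinh t : ℂ) ^ 2 := by
    exact_mod_cast (by rw [Real.cosh_sq]; ring : Real.cosh t ^ 2 = 1 + Real.sinh t ^ 2)
  have hc0 : (Real.cosh t : ℂ) ≠ 0 := by exact_mod_cast (Real.cosh_pos t).ne'
  have hw : ‖((Real.tanh t : ℝ) : ℂ)‖ < 1 := by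
    rw [Complex.norm_real, Real.norm_eq_abs, abs_lt]
    exact ⟨Real.neg_one_lt_tanh t, Real.tanh_lt_one t⟩
  set a : ℂ := ((jacobiRho α β : ℝ) + Complex.I * l) / 2 with ha
  have e1 : 1 - -((Real.sinh t : ℝ) : ℂ) ^ 2 = ((Real.cosh t ^ 2 : ℝ) : ℂ) := by
    rw [Complex.ofReal_pow, hcosh]; ring
  have e2 : -((Real.sinh t : ℝ) : ℂ) ^ 2 / (-((Real.sinh t : ℝ) : ℂ) ^ 2 - 1) =
      ((Real.tanh t : ℝ) : ℂ) ^ 2 := by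
    rw [Real.tanh_eq_sinh_div_cosh, Complex.ofReal_div, div_pow,
      show -((Real.sinh t : ℝ) : ℂ) ^ 2 - 1 = -((Real.cosh t : ℂ) ^ 2) by rw [hcosh]; ring,
      neg_div_neg_eq]
  have e3 : (α : ℂ) + 1 - ((jacobiRho α β : ℝ) - Complex.I * l) / 2 = a - β := by
    rw [ha, jacobiRho]; push_cast; ring
  have e4 : (α : ℂ) + 1 = ((α + 1 : ℝ) : ℂ) := by push_cast; ring
  rw [jacobiFunction, gaussHypergeometric, e1, e2, e3, e4, ← integral_distSq a hβ hβα hw,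
    ← integral_const_mul]
  refine integral_congr_ae ?_
  filter_upwards [ae_jacobiMeasure_mem hβ hβα] with p hp
  have h1 := cosh_sq_cpow_mul_distSq_cpow a t hp.1 hp.2
  have h2 := cosh_sq_cpow_mul_distSq_cpow a (-t) hp.1 hp.2
  rw [Real.cosh_neg, Real.tanh_neg, Complex.ofReal_neg] at h2
  rw [mul_div_assoc', mul_add, h1, h2, show 2 * a = jacobiRho α β + Complex.I * l by rw [ha]; ring]

/-- The symmetry in the upper parameters is not visible in the defining formula of
`gaussHypergeometric`; it is inherited from Gauss' series near `0` by analytic continuation. -/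
theorem gaussHypergeometric_symm (a b c : ℂ) (hc : ∀ k : ℕ, c ≠ -(k : ℂ)) {z : ℂ}
    (hz : z.re < 1 / 2) : gaussHypergeometric a b c z = gaussHypergeometric b a c z := by
  have hloc : gaussHypergeometric a b c =ᶠ[nhds 0] gaussHypergeometric b a c := by
    refine (gaussHypergeometric_eventuallyEq a b c hc).trans ?_
    have : (ordinaryHypergeometric a b c : ℂ → ℂ) = ordinaryHypergeometric b a c := by
      funext z
      rw [ordinaryHypergeometric, ordinaryHypergeometric, ordinaryHypergeometricSeries_symm]
    rw [this]
    exact (gaussHypergeometric_eventuallyEq b a c hc).symm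
  exact (gaussHypergeometric_analyticOnNhd a b c).eqOn_of_preconnected_of_eventuallyEq
    (gaussHypergeometric_analyticOnNhd b a c) (convex_halfSpace_re_lt _).isPreconnected
    (by simp : (0 : ℂ) ∈ {z : ℂ | z.re < 1 / 2}) hloc hz

theorem jacobiFunction_neg {α : ℝ} (β : ℝ) (hα : -1 < α) (l : ℂ) (t : ℝ) :
    jacobiFunction α β (-l) t = jacobiFunction α β l t := by
  rw [jacobiFunction, jacobiFunction, gaussHypergeometric_symm]
  · congr 2 <;> ring
  · intro k hk
    have := congrArg Complex.re hk
    simp at this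
    have : (0 : ℝ) ≤ k := Nat.cast_nonneg k
    linarith
  · rw [← Complex.ofReal_pow, ← Complex.ofReal_neg, Complex.ofReal_re]
    nlinarith [sq_nonneg (Real.sinh t)]

/-! ### `1 - Re φ` as the mean of a nonnegative function -/

theorem integrable_comp_logDist {E : Type*} [NormedAddCommGroup E] {α β : ℝ}
    (hβ : -1 / 2 ≤ β) (hβα : β ≤ α) {h : ℝ → E} (hh : Continuous h) (t : ℝ) :
    Integrable (fun p ↦ h (logDist t p)) (jacobiMeasure α β) := by
  have := isProbabilityMeasure_jacobiMeasure hβ hβα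
  obtain ⟨C, hC⟩ := (isCompact_Icc (a := -|t|) (b := |t|)).exists_bound_of_continuousOn
    hh.continuousOn
  refine Integrable.of_bound
    (hh.stronglyMeasurable.comp_measurable (measurable_logDist t)).aestronglyMeasurable C ?_
  filter_upwards [ae_jacobiMeasure_mem hβ hβα] with p hp
  exact hC _ (abs_le.1 (abs_logDist_le t hp.1 hp.2))

/-- The real part of a Jacobi function as a cosine transform. Averaging the integral formula over
`l` and `-l` produces the factor `cosh (η L) cos (μ L)`. -/
theorem re_jacobiFunction {α β : ℝ} (hβ : -1 / 2 ≤ β) (hβα : β ≤ α) (μ η t : ℝ) :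
    (jacobiFunction α β ((μ : ℂ) + Complex.I * (η : ℂ)) t).re =
      ∫ p, (Real.exp (-(jacobiRho α β * logDist t p)) * (Real.cosh (η * logDist t p) *
          Real.cos (μ * logDist t p)) +
        Real.exp (-(jacobiRho α β * logDist (-t) p)) * (Real.cosh (η * logDist (-t) p) *
          Real.cos (μ * logDist (-t) p))) / 2 ∂(jacobiMeasure α β) := by
  set ρ := jacobiRho α β with hρ
  have hre : ∀ μ η : ℝ, (jacobiFunction α β ((μ : ℂ) + Complex.I * (η : ℂ)) t).re =
      ∫ p, (Real.exp (-((ρ - η) * logDist t p)) * Real.cos (μ * logDist t p) +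
        Real.exp (-((ρ - η) * logDist (-t) p)) * Real.cos (μ * logDist (-t) p)) / 2
        ∂(jacobiMeasure α β) := fun μ η ↦ by
    have e : ∀ L : ℝ, (Complex.exp (-(ρ + Complex.I * ((μ : ℂ) + Complex.I * (η : ℂ))) * L)).re =
        Real.exp (-((ρ - η) * L)) * Real.cos (μ * L) := fun L ↦ by
      rw [Complex.exp_re]
      simp only [Complex.mul_re, Complex.mul_im, Complex.neg_re, Complex.neg_im, Complex.add_re,
        Complex.add_im, Complex.ofReal_re, Complex.ofReal_im, Complex.I_re, Complex.I_im]
      rw [← Real.cos_neg (μ * L)]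
      congr 2 <;> ring
    have hi : ∀ t, Integrable (fun p ↦ Complex.exp (-(ρ + Complex.I *
        ((μ : ℂ) + Complex.I * (η : ℂ))) * logDist t p)) (jacobiMeasure α β) :=
      integrable_comp_logDist hβ hβα (h := fun L : ℝ ↦ Complex.exp (-(ρ + Complex.I *
        ((μ : ℂ) + Complex.I * (η : ℂ))) * L)) (by fun_prop)
    rw [jacobiFunction_eq_integral hβ hβα, ← hρ]
    have := Complex.reCLM.integral_comp_comm (((hi t).add (hi (-t))).div_const 2)
    simp only [Complex.reCLM_apply, Pi.add_apply] at this
    rw [← this]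
    refine integral_congr_ae (Filter.Eventually.of_forall fun p ↦ ?_)
    simp only [Complex.div_ofNat_re, Complex.add_re, e]
  have h1 := hre μ η
  have h2 := hre (-μ) (-η)
  rw [show ((-μ : ℝ) : ℂ) + Complex.I * ((-η : ℝ) : ℂ) = -((μ : ℂ) + Complex.I * (η : ℂ)) by
    push_cast; ring, jacobiFunction_neg β (by linarith)] at h2
  have hi : ∀ μ η : ℝ, Integrable (fun p ↦
      (Real.exp (-((ρ - η) * logDist t p)) * Real.cos (μ * logDist t p) +
        Real.exp (-((ρ - η) * logDist (-t) p)) * Real.cos (μ * logDist (-t) p)) / 2)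
        (jacobiMeasure α β) := fun μ η ↦ by
    have h : ∀ t, Integrable (fun p ↦ Real.exp (-((ρ - η) * logDist t p)) *
        Real.cos (μ * logDist t p)) (jacobiMeasure α β) := integrable_comp_logDist hβ hβα
      (h := fun L ↦ Real.exp (-((ρ - η) * L)) * Real.cos (μ * L)) (by fun_prop)
    exact ((h t).add (h (-t))).div_const 2
  have h3 : (jacobiFunction α β ((μ : ℂ) + Complex.I * (η : ℂ)) t).re =
      ((jacobiFunction α β ((μ : ℂ) + Complex.I * (η : ℂ)) t).re +
        (jacobiFunction α β ((μ : ℂ) + Complex.I * (η : ℂ)) t).re) / 2 := by ring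
  rw [h3]
  nth_rewrite 1 [h1]
  rw [h2, ← integral_add (hi μ η) (hi (-μ) (-η)), ← integral_div]
  refine integral_congr_ae (Filter.Eventually.of_forall fun p ↦ ?_)
  have e : ∀ L : ℝ, Real.exp (-(ρ * L)) * (Real.cosh (η * L) * Real.cos (μ * L)) =
      (Real.exp (-((ρ - η) * L)) * Real.cos (μ * L) +
        Real.exp (-((ρ - -η) * L)) * Real.cos (-μ * L)) / 2 := fun L ↦ by
    rw [neg_mul, Real.cos_neg, Real.cosh_eq, show -((ρ - η) * L) = -(ρ * L) + η * L by ring,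
      show -((ρ - -η) * L) = -(ρ * L) + -(η * L) by ring, Real.exp_add, Real.exp_add]
    ring
  simp only [e]
  ring

/-- At `l = iρ` the Jacobi function is the constant `1`. -/
theorem jacobiFunction_I_mul_jacobiRho {α β : ℝ} (hβ : -1 / 2 ≤ β) (hβα : β ≤ α) (t : ℝ) :
    jacobiFunction α β (Complex.I * (jacobiRho α β : ℝ)) t = 1 := by
  have := isProbabilityMeasure_jacobiMeasure hβ hβα
  rw [jacobiFunction_eq_integral hβ hβα]
  simp [← mul_assoc]

/-- The function of `L = log D` whose mean is `1 - Re φ_{μ + iη}`. The term `cosh (ρ L)` comes from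
writing `1` as `φ_{iρ}`. -/
noncomputable def jacobiGap (ρ μ η L : ℝ) : ℝ :=
  Real.exp (-(ρ * L)) * (Real.cosh (ρ * L) - Real.cosh (η * L) * Real.cos (μ * L))

theorem continuous_jacobiGap (ρ μ η : ℝ) : Continuous (jacobiGap ρ μ η) := by
  unfold jacobiGap; fun_prop

theorem one_sub_re_jacobiFunction {α β : ℝ} (hβ : -1 / 2 ≤ β) (hβα : β ≤ α) (μ η t : ℝ) :
    1 - (jacobiFunction α β ((μ : ℂ) + Complex.I * (η : ℂ)) t).re =
      ∫ p, (jacobiGap (jacobiRho α β) μ η (logDist t p) +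
        jacobiGap (jacobiRho α β) μ η (logDist (-t) p)) / 2 ∂(jacobiMeasure α β) := by
  have h1 : (1 : ℝ) = (jacobiFunction α β (((0 : ℝ) : ℂ) +
      Complex.I * ((jacobiRho α β : ℝ) : ℂ)) t).re := by
    rw [Complex.ofReal_zero, zero_add, jacobiFunction_I_mul_jacobiRho hβ hβα, Complex.one_re]
  have hi : ∀ μ η : ℝ, Integrable (fun p ↦
      (Real.exp (-(jacobiRho α β * logDist t p)) * (Real.cosh (η * logDist t p) *
          Real.cos (μ * logDist t p)) +
        Real.exp (-(jacobiRho α β * logDist (-t) p)) * (Real.cosh (η * logDist (-t) p) *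
          Real.cos (μ * logDist (-t) p))) / 2) (jacobiMeasure α β) := fun μ η ↦ by
    have h : ∀ t, Integrable (fun p ↦ Real.exp (-(jacobiRho α β * logDist t p)) *
        (Real.cosh (η * logDist t p) * Real.cos (μ * logDist t p))) (jacobiMeasure α β) :=
      integrable_comp_logDist hβ hβα (h := fun L ↦ Real.exp (-(jacobiRho α β * L)) *
        (Real.cosh (η * L) * Real.cos (μ * L))) (by fun_prop)
    exact ((h t).add (h (-t))).div_const 2
  nth_rewrite 1 [h1]
  rw [re_jacobiFunction hβ hβα, re_jacobiFunction hβ hβα, ← integral_sub (hi _ _) (hi _ _)]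
  refine integral_congr_ae (Filter.Eventually.of_forall fun p ↦ ?_)
  simp only [jacobiGap, zero_mul, Real.cos_zero]
  ring

section Gap

variable {ρ η η₀ : ℝ}

theorem mul_one_sub_cos_le_jacobiGap (hρ : 0 ≤ ρ) (hη : |η| ≤ ρ) (μ L : ℝ) :
    Real.exp (-(ρ * L)) * (1 - Real.cos (μ * L)) ≤ jacobiGap ρ μ η L := by
  refine mul_le_mul_of_nonneg_left ?_ (Real.exp_pos _).le
  have h1 : Real.cosh (η * L) ≤ Real.cosh (ρ * L) := by
    rw [Real.cosh_le_cosh, abs_mul, abs_mul, abs_of_nonneg hρ]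
    gcongr
  have h2 := Real.one_le_cosh (η * L)
  have h3 := Real.cos_le_one (μ * L)
  nlinarith

theorem jacobiGap_nonneg (hρ : 0 ≤ ρ) (hη : |η| ≤ ρ) (μ L : ℝ) : 0 ≤ jacobiGap ρ μ η L :=
  (mul_nonneg (Real.exp_pos _).le (by linarith [Real.cos_le_one (μ * L)])).trans
    (mul_one_sub_cos_le_jacobiGap hρ hη μ L)

/-- The bound for large `t`: replacing `cosh ηL cos μL` by `cosh η₀L` leaves
`(1 - e^{-(ρ - η₀) L}) (1 - e^{-(ρ + η₀) L}) / 2`, which is increasing in `L > 0`. -/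
theorem sq_div_two_le_jacobiGap (hη : |η| ≤ η₀) (hη₀ : 0 ≤ η₀) (hη₀ρ : η₀ < ρ) (μ : ℝ)
    {L₀ L : ℝ} (hL₀ : 0 < L₀) (hL : L₀ ≤ L) :
    (1 - Real.exp (-((ρ - η₀) * L₀))) ^ 2 / 2 ≤ jacobiGap ρ μ η L := by
  have h1 : Real.cosh (η * L) * Real.cos (μ * L) ≤ Real.cosh (η₀ * L) := by
    have h2 : Real.cosh (η * L) ≤ Real.cosh (η₀ * L) := by
      rw [Real.cosh_le_cosh, abs_mul, abs_mul, abs_of_nonneg hη₀]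
      gcongr
    exact (mul_le_of_le_one_right (Real.cosh_pos _).le (Real.cos_le_one _)).trans h2
  have h2 : Real.exp (-(ρ * L)) * (Real.cosh (ρ * L) - Real.cosh (η₀ * L)) =
      (1 - Real.exp (-((ρ - η₀) * L))) * (1 - Real.exp (-((ρ + η₀) * L))) / 2 := by
    have e1 : Real.exp (-(ρ * L)) * Real.exp (ρ * L) = 1 := by rw [← Real.exp_add]; simp
    rw [Real.cosh_eq, Real.cosh_eq, show -((ρ - η₀) * L) = -(ρ * L) + η₀ * L by ring,
      show -((ρ + η₀) * L) = -(ρ * L) + -(η₀ * L) by ring, Real.exp_add, Real.exp_add]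
    have e2 : Real.exp (η₀ * L) * Real.exp (-(η₀ * L)) = 1 := by rw [← Real.exp_add]; simp
    linear_combination (1 / 2 : ℝ) * e1 - (1 / 2 : ℝ) * Real.exp (-(ρ * L)) ^ 2 * e2
  have h3 : Real.exp (-((ρ - η₀) * L)) ≤ Real.exp (-((ρ - η₀) * L₀)) :=
    Real.exp_le_exp.2 (by nlinarith)
  have h4 : Real.exp (-((ρ + η₀) * L)) ≤ Real.exp (-((ρ - η₀) * L₀)) :=
    Real.exp_le_exp.2 (by nlinarith)
  have h5 : Real.exp (-((ρ - η₀) * L₀)) ≤ 1 := Real.exp_le_one_iff.2 (by nlinarith)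
  calc _ ≤ (1 - Real.exp (-((ρ - η₀) * L))) * (1 - Real.exp (-((ρ + η₀) * L))) / 2 := by
        rw [sq]
        gcongr
        linarith
    _ = Real.exp (-(ρ * L)) * (Real.cosh (ρ * L) - Real.cosh (η₀ * L)) := h2.symm
    _ ≤ jacobiGap ρ μ η L := by
        unfold jacobiGap
        gcongr

end Gap

theorem log_cosh_le_logDist {t : ℝ} (ht : 0 ≤ t) {p : ℝ × ℝ} (hp1 : 0 ≤ p.1) :
    Real.log (Real.cosh t) ≤ logDist t p := by
  have hK := Real.cosh_pos t
  have hS := Real.sinh_nonneg_iff.2 ht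
  have h : Real.log (Real.cosh t ^ 2) ≤ Real.log (Real.cosh t ^ 2 +
      2 * √(p.1 * p.2) * (Real.sinh t * Real.cosh t) + Real.sinh t ^ 2 * p.1) := by
    refine Real.log_le_log (by positivity) ?_
    have : 0 ≤ 2 * √(p.1 * p.2) * (Real.sinh t * Real.cosh t) := by positivity
    have : 0 ≤ Real.sinh t ^ 2 * p.1 := by positivity
    linarith
  rw [Real.log_pow] at h
  rw [logDist]
  push_cast at h
  linarith

/-! ### Oscillation of the logarithm of the distance -/

/-- A form of `h - |sin h| ≳ min (h, h ^ 3)` that is monotone in `h` on the left. -/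
theorem mul_min_le_sub_abs_sin {h : ℝ} (hh : 0 ≤ h) :
    h * min 1 (h ^ 2) / 40 ≤ h - |Real.sin h| := by
  have small : ∀ x : ℝ, 0 ≤ x → x ≤ 1 → 11 / 96 * x ^ 3 ≤ x - |Real.sin x| := fun x h0 h1 ↦ by
    rw [abs_of_nonneg (Real.sin_nonneg_of_nonneg_of_le_pi h0 (by linarith [Real.pi_gt_three]))]
    have := (abs_le.1 (Real.sin_bound (x := x) (by rwa [abs_of_nonneg h0]))).2
    rw [abs_of_nonneg h0] at this
    have h2 : x ^ 5 ≤ x ^ 3 := pow_le_pow_of_le_one h0 h1 (by norm_num)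
    have h3 : 0 ≤ x ^ 3 := pow_nonneg h0 3
    linarith
  rcases le_total h 1 with h1 | h1
  · have := small h hh h1
    have h2 : h * min 1 (h ^ 2) ≤ h * h ^ 2 := by gcongr; exact min_le_right _ _
    nlinarith [pow_nonneg hh 3]
  have h2 : h * min 1 (h ^ 2) ≤ h * 1 := by gcongr; exact min_le_left _ _
  rcases le_total h 2 with h3 | h3
  · -- here the bound for `h / 2` suffices, as `|sin h| ≤ 2 |sin (h / 2)|`
    have h4 := small (h / 2) (by linarith) (by linarith)
    have h5 : |Real.sin h| ≤ 2 * |Real.sin (h / 2)| := by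
      have : Real.sin h = 2 * Real.sin (h / 2) * Real.cos (h / 2) := by
        rw [← Real.sin_two_mul]; congr 1; ring
      rw [this, abs_mul, abs_mul, abs_two]
      exact mul_le_of_le_one_right (by positivity) (Real.abs_cos_le_one _)
    have h6 : h ≤ h ^ 3 := by nlinarith
    linarith
  · linarith [Real.abs_sin_le_one h]

/-- If `g` has derivative comparable to a constant, then the oscillation of `cos (μ g)` keeps its
mean away from `1`. The reason is that `(1 - cos (μ g)) g'` is the derivative of
`g - sin (μ g) / μ`. -/
theorem le_integral_one_sub_cos {a b : ℝ} (ha : 0 < a) (hb : 0 < b) (μ : ℝ) {g g' : ℝ → ℝ}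
    (hg : ∀ s ∈ Icc (1 / 4 : ℝ) (3 / 4), HasDerivAt g (g' s) s)
    (hg' : ContinuousOn g' (Icc (1 / 4 : ℝ) (3 / 4)))
    (hga : ∀ s ∈ Icc (1 / 4 : ℝ) (3 / 4), a ≤ g' s)
    (hgb : ∀ s ∈ Icc (1 / 4 : ℝ) (3 / 4), g' s ≤ b) :
    a / (80 * b) * min 1 ((μ * a / 4) ^ 2) ≤
      ∫ s in Icc (1 / 4 : ℝ) (3 / 4), (1 - Real.cos (μ * g s)) := by
  wlog hμ : 0 < μ generalizing μ
  · rcases (not_lt.1 hμ).eq_or_lt with rfl | hμ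
    · simp
    · have := this (-μ) (by linarith)
      simp only [neg_mul, Real.cos_neg] at this
      rwa [neg_div, neg_sq] at this
  have hu : uIcc (1 / 4 : ℝ) (3 / 4) = Icc (1 / 4) (3 / 4) := uIcc_of_le (by norm_num)
  rw [integral_Icc_eq_integral_Ioc, ← intervalIntegral.integral_of_le (by norm_num)]
  have hgc : ContinuousOn g (Icc (1 / 4 : ℝ) (3 / 4)) := fun s hs ↦
    (hg s hs).continuousAt.continuousWithinAt
  have hc1 : ContinuousOn (fun s ↦ 1 - Real.cos (μ * g s)) (Icc (1 / 4 : ℝ) (3 / 4)) := by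
    fun_prop
  have hI1 : IntervalIntegrable (fun s ↦ (1 - Real.cos (μ * g s)) * g' s) volume (1 / 4) (3 / 4) :=
    ContinuousOn.intervalIntegrable (by rw [hu]; exact hc1.mul hg')
  have hI2 : IntervalIntegrable (fun s ↦ b * (1 - Real.cos (μ * g s))) volume (1 / 4) (3 / 4) :=
    ContinuousOn.intervalIntegrable (by rw [hu]; exact continuousOn_const.mul hc1)
  have hftc : ∫ s in (1 / 4 : ℝ)..(3 / 4), (1 - Real.cos (μ * g s)) * g' s =
      (g (3 / 4) - Real.sin (μ * g (3 / 4)) / μ) - (g (1 / 4) - Real.sin (μ * g (1 / 4)) / μ) := by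
    refine intervalIntegral.integral_eq_sub_of_hasDerivAt
      (f := fun s ↦ g s - Real.sin (μ * g s) / μ) (fun s hs ↦ ?_) hI1
    rw [hu] at hs
    refine ((hg s hs).fun_sub ((((hg s hs).const_mul μ).sin).div_const μ)).congr_deriv ?_
    field_simp
  have hmono : ∫ s in (1 / 4 : ℝ)..(3 / 4), (1 - Real.cos (μ * g s)) * g' s ≤
      ∫ s in (1 / 4 : ℝ)..(3 / 4), b * (1 - Real.cos (μ * g s)) := by
    refine intervalIntegral.integral_mono_on (by norm_num) hI1 hI2 fun s hs ↦ ?_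
    rw [mul_comm b]
    have := Real.cos_le_one (μ * g s)
    exact mul_le_mul_of_nonneg_left (hgb s hs) (by linarith)
  rw [intervalIntegral.integral_const_mul, hftc] at hmono
  have hΔ : a / 2 ≤ g (3 / 4) - g (1 / 4) := by
    have := (convex_Icc (1 / 4 : ℝ) (3 / 4)).mul_sub_le_image_sub_of_le_deriv (f := g) (C := a) hgc
      (fun s hs ↦ (hg s (interior_subset hs)).differentiableAt.differentiableWithinAt)
      (fun s hs ↦ by rw [(hg s (interior_subset hs)).deriv]; exact hga s (interior_subset hs))
      (1 / 4) (by norm_num) (3 / 4) (by norm_num) (by norm_num)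
    linarith
  set Δ := g (3 / 4) - g (1 / 4) with hΔdef
  set h := μ * Δ / 2 with hh
  have hha : μ * a / 4 ≤ h := by
    have : μ * (a / 2) ≤ μ * Δ := by gcongr
    linarith
  have h0 : 0 ≤ μ * a / 4 := by positivity
  have hsin : Real.sin (μ * g (3 / 4)) - Real.sin (μ * g (1 / 4)) ≤ 2 * |Real.sin h| := by
    rw [Real.sin_sub_sin, show (μ * g (3 / 4) - μ * g (1 / 4)) / 2 = h by rw [hh, hΔdef]; ring]
    calc 2 * Real.sin h * Real.cos ((μ * g (3 / 4) + μ * g (1 / 4)) / 2)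
        ≤ |2 * Real.sin h * Real.cos ((μ * g (3 / 4) + μ * g (1 / 4)) / 2)| := le_abs_self _
      _ = 2 * |Real.sin h| * |Real.cos ((μ * g (3 / 4) + μ * g (1 / 4)) / 2)| := by
          rw [abs_mul, abs_mul, abs_two]
      _ ≤ _ := mul_le_of_le_one_right (by positivity) (Real.abs_cos_le_one _)
  have hmin := mul_min_le_sub_abs_sin (h0.trans hha)
  have hmin2 : μ * a / 4 * min 1 ((μ * a / 4) ^ 2) ≤ h * min 1 (h ^ 2) := by
    have := h0.trans hha
    gcongr
  have key : μ * a / 4 * min 1 ((μ * a / 4) ^ 2) / 20 ≤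
      μ * (b * ∫ s in (1 / 4 : ℝ)..(3 / 4), (1 - Real.cos (μ * g s))) := by
    have h3 : μ * (g (3 / 4) - Real.sin (μ * g (3 / 4)) / μ - (g (1 / 4) -
        Real.sin (μ * g (1 / 4)) / μ)) =
        2 * h - (Real.sin (μ * g (3 / 4)) - Real.sin (μ * g (1 / 4))) := by
      rw [hh, hΔdef]; field_simp; ring
    have h4 := mul_le_mul_of_nonneg_left hmono hμ.le
    rw [h3] at h4
    linarith
  generalize (∫ s in (1 / 4 : ℝ)..(3 / 4), (1 - Real.cos (μ * g s))) = J at *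
  generalize min 1 ((μ * a / 4) ^ 2) = M at *
  have h5 : a * M / 80 ≤ b * J := by
    refine le_of_mul_le_mul_left (a := μ) ?_ hμ
    linarith
  rw [div_mul_eq_mul_div, div_le_iff₀ (by positivity)]
  linarith

section Derivatives

variable {t : ℝ}

theorem sinh_mul_cosh_bounds (ht : 0 < t) (ht1 : t ≤ 1) : t ≤ Real.sinh t ∧ Real.sinh t ≤ 2 * t ∧
    1 ≤ Real.cosh t ∧ Real.cosh t ≤ 2 := by
  refine ⟨Real.self_le_sinh_iff.2 ht.le, ?_, Real.one_le_cosh t, ?_⟩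
  · have h1 := (abs_le.1 (Real.abs_exp_sub_one_sub_id_le (x := t) (by rwa [abs_of_pos ht]))).2
    have h2 := Real.add_one_le_exp (-t)
    rw [Real.sinh_eq]
    nlinarith
  · have h1 := (abs_le.1 (Real.abs_exp_sub_one_sub_id_le (x := t) (by rwa [abs_of_pos ht]))).2
    have h2 : Real.exp (-t) ≤ 1 := Real.exp_le_one_iff.2 (by linarith)
    rw [Real.cosh_eq]
    nlinarith

theorem logDist_arg_bounds (ht : 0 < t) (ht1 : t ≤ 1) {p : ℝ × ℝ}
    (hp1 : p.1 ∈ Icc (0 : ℝ) 1) (hp2 : p.2 ∈ Icc (0 : ℝ) 1) :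
    1 ≤ Real.cosh t ^ 2 + 2 * √(p.1 * p.2) * (Real.sinh t * Real.cosh t) + Real.sinh t ^ 2 * p.1 ∧
    Real.cosh t ^ 2 + 2 * √(p.1 * p.2) * (Real.sinh t * Real.cosh t) + Real.sinh t ^ 2 * p.1 ≤ 9 := by
  obtain ⟨h1, -, h2, -⟩ := sinh_mul_cosh_bounds ht ht1
  constructor
  · have : 0 ≤ 2 * √(p.1 * p.2) * (Real.sinh t * Real.cosh t) := by
      have : 0 ≤ Real.sinh t := by linarith
      positivity
    have : 0 ≤ Real.sinh t ^ 2 * p.1 := mul_nonneg (sq_nonneg _) hp1.1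
    nlinarith
  · refine (logDist_arg_upper t hp1 hp2).trans ?_
    have h3 : Real.exp |t| ≤ 3 := by
      rw [abs_of_pos ht]
      linarith [Real.exp_le_exp.2 ht1, Real.exp_one_lt_d9]
    nlinarith [Real.exp_pos |t|]

/-- For fixed radius, `log D` moves in the angular variable at speed comparable to `t`. -/
theorem exists_hasDerivAt_logDist_snd (ht : 0 < t) (ht1 : t ≤ 1) {r : ℝ}
    (hr : r ∈ Icc (1 / 4 : ℝ) 1) : ∃ g' : ℝ → ℝ, ContinuousOn g' (Icc (1 / 4 : ℝ) (3 / 4)) ∧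
      ∀ s ∈ Icc (1 / 4 : ℝ) (3 / 4), HasDerivAt (fun s ↦ logDist t (r, s)) (g' s) s ∧
        t / 72 ≤ g' s ∧ g' s ≤ 16 * t := by
  obtain ⟨hS1, hS2, hK1, hK2⟩ := sinh_mul_cosh_bounds ht ht1
  obtain ⟨hr1, hr2⟩ := hr
  have hD : ∀ s ∈ Icc (1 / 4 : ℝ) (3 / 4), _ := fun s hs ↦ logDist_arg_bounds ht ht1 (p := (r, s))
    ⟨by simp only; linarith, hr2⟩ ⟨by simp only; linarith [hs.1], by simp only; linarith [hs.2]⟩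
  have hsq : ∀ s ∈ Icc (1 / 4 : ℝ) (3 / 4), 1 / 4 ≤ √(r * s) ∧ √(r * s) ≤ 1 := fun s hs ↦ by
    constructor
    · exact Real.le_sqrt_of_sq_le (by nlinarith [hs.1])
    · exact Real.sqrt_le_one.2 (by nlinarith [hs.1, hs.2])
  simp only at hD
  refine ⟨fun s ↦ 2 * (r / (2 * √(r * s))) * (Real.sinh t * Real.cosh t) / (Real.cosh t ^ 2 +
    2 * √(r * s) * (Real.sinh t * Real.cosh t) + Real.sinh t ^ 2 * r) / 2, ?_, fun s hs ↦ ?_⟩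
  · refine ContinuousOn.div_const (ContinuousOn.div (ContinuousOn.mul (continuousOn_const.mul
      (ContinuousOn.div continuousOn_const (by fun_prop) fun s hs ↦ ?_)) continuousOn_const)
      (by fun_prop) fun s hs ↦ ?_) 2
    · linarith [(hsq s hs).1]
    · linarith [(hD s hs).1]
  · obtain ⟨hD1, hD9⟩ := hD s hs
    obtain ⟨hq1, hq2⟩ := hsq s hs
    have hpos : 0 < r * s := by nlinarith [hs.1]
    refine ⟨?_, ?_⟩
    · have h1 : HasDerivAt (fun s ↦ √(r * s)) (r / (2 * √(r * s))) s := by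
        have := ((hasDerivAt_id s).const_mul r).sqrt hpos.ne'
        simpa using this
      unfold logDist
      exact (((((h1.const_mul 2).mul_const _).const_add _).add_const _).log
        (ne_of_gt (one_pos.trans_le (by assumption)))).div_const 2
    · beta_reduce
      clear hD hsq
      generalize √(r * s) = q at *
      generalize Real.cosh t ^ 2 + 2 * q * (Real.sinh t * Real.cosh t) +
        Real.sinh t ^ 2 * r = D at *
      have hSK1 : t ≤ Real.sinh t * Real.cosh t := by nlinarith
      have hSK2 : Real.sinh t * Real.cosh t ≤ 4 * t := by nlinarith
      generalize Real.sinh t * Real.cosh t = P at *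
      have e : 2 * (r / (2 * q)) * P / D / 2 = r * P / (2 * (q * D)) := by
        field_simp
      rw [e]
      constructor
      · rw [le_div_iff₀ (by positivity)]
        have : q * D ≤ 1 * 9 := by gcongr
        have : 1 / 4 * t ≤ r * P := by gcongr
        nlinarith
      · rw [div_le_iff₀ (by positivity)]
        have : 1 / 4 * 1 ≤ q * D := by gcongr
        have hP : 0 ≤ P := by linarith
        have : r * P ≤ 1 * (4 * t) := by gcongr
        nlinarith

/-- On the ray `ψ = 0`, `log D` moves in the radial variable at speed comparable to `t`. -/
theorem exists_hasDerivAt_logDist_fst (ht : 0 < t) (ht1 : t ≤ 1) :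
    ∃ g' : ℝ → ℝ, ContinuousOn g' (Icc (1 / 4 : ℝ) (3 / 4)) ∧
      ∀ s ∈ Icc (1 / 4 : ℝ) (3 / 4), HasDerivAt (fun s ↦ logDist t (s, 1)) (g' s) s ∧
        t / 72 ≤ g' s ∧ g' s ≤ 16 * t := by
  obtain ⟨hS1, hS2, hK1, hK2⟩ := sinh_mul_cosh_bounds ht ht1
  have hD : ∀ s ∈ Icc (1 / 4 : ℝ) (3 / 4), _ := fun s hs ↦ logDist_arg_bounds ht ht1 (p := (s, 1))
    ⟨by simp only; linarith [hs.1], by simp only; linarith [hs.2]⟩ ⟨zero_le_one, le_rfl⟩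
  have hsq : ∀ s ∈ Icc (1 / 4 : ℝ) (3 / 4), 1 / 4 ≤ √s ∧ √s ≤ 1 := fun s hs ↦ by
    constructor
    · exact Real.le_sqrt_of_sq_le (by nlinarith [hs.1])
    · exact Real.sqrt_le_one.2 (by linarith [hs.2])
  simp only [mul_one] at hD
  refine ⟨fun s ↦ (2 * (1 / (2 * √s)) * (Real.sinh t * Real.cosh t) + Real.sinh t ^ 2) /
    (Real.cosh t ^ 2 + 2 * √s * (Real.sinh t * Real.cosh t) + Real.sinh t ^ 2 * s) / 2, ?_,
    fun s hs ↦ ?_⟩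
  · refine ContinuousOn.div_const (ContinuousOn.div (ContinuousOn.add (ContinuousOn.mul
      (continuousOn_const.mul (ContinuousOn.div continuousOn_const (by fun_prop) fun s hs ↦ ?_))
      continuousOn_const) continuousOn_const) (by fun_prop) fun s hs ↦ ?_) 2
    · linarith [(hsq s hs).1]
    · linarith [(hD s hs).1]
  · obtain ⟨hD1, hD9⟩ := hD s hs
    obtain ⟨hq1, hq2⟩ := hsq s hs
    refine ⟨?_, ?_⟩
    · have h1 : HasDerivAt (fun s ↦ √s) (1 / (2 * √s)) s := Real.hasDerivAt_sqrt (by linarith [hs.1])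
      have h2 : HasDerivAt (fun s ↦ Real.sinh t ^ 2 * s) (Real.sinh t ^ 2) s := by
        simpa using (hasDerivAt_id s).const_mul (Real.sinh t ^ 2)
      simp only [logDist, mul_one]
      exact (((((h1.const_mul 2).mul_const _).const_add _).fun_add h2).log
        (ne_of_gt (one_pos.trans_le (by assumption)))).div_const 2
    · beta_reduce
      clear hD hsq
      generalize √s = q at *
      generalize Real.cosh t ^ 2 + 2 * q * (Real.sinh t * Real.cosh t) +
        Real.sinh t ^ 2 * s = D at *
      have hSK1 : t ≤ Real.sinh t * Real.cosh t := by nlinarith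
      have hSK2 : Real.sinh t * Real.cosh t ≤ 2 * t * 2 := by gcongr
      have hSS : Real.sinh t ^ 2 ≤ 4 * t := by nlinarith
      have hSS0 := sq_nonneg (Real.sinh t)
      generalize Real.sinh t * Real.cosh t = P at *
      generalize Real.sinh t ^ 2 = Q at *
      have e : (2 * (1 / (2 * q)) * P + Q) / D / 2 = (P + q * Q) / (2 * (q * D)) := by
        field_simp
      rw [e]
      constructor
      · rw [le_div_iff₀ (by positivity)]
        have : q * D ≤ 1 * 9 := by gcongr
        have : 0 ≤ q * Q := by positivity
        nlinarith
      · rw [div_le_iff₀ (by positivity)]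
        have : 1 / 4 * 1 ≤ q * D := by gcongr
        have : q * Q ≤ 1 * (4 * t) := by gcongr
        nlinarith

end Derivatives

/-- Lower bound for the oscillation seen by one of the two beta laws. -/
theorem exists_le_integral_betaLaw_one_sub_cos {p q : ℝ} (hp : 0 < p) (hq : 0 < q) :
    ∃ c : ℝ, 0 < c ∧ ∀ (μ t : ℝ) (g g' : ℝ → ℝ), 0 < t → Measurable g →
      ContinuousOn g' (Icc (1 / 4 : ℝ) (3 / 4)) →
      (∀ s ∈ Icc (1 / 4 : ℝ) (3 / 4), HasDerivAt g (g' s) s ∧ t / 72 ≤ g' s ∧ g' s ≤ 16 * t) →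
      c * min 1 ((μ * t) ^ 2) ≤ ∫ s, (1 - Real.cos (μ * g s)) ∂(betaLaw p q) := by
  have := isProbabilityMeasure_betaLaw hp hq.le
  obtain ⟨c, hc, hle⟩ := exists_smul_volume_le_betaLaw hp hq
  have hc' : (0 : ℝ) < c := by exact_mod_cast hc
  -- with `a = t / 72`, `b = 16 t` one has `a / (80 b) = 1 / 92160` and `(a / (4 t)) ^ 2 = 1 / 82944`
  refine ⟨c * (1 / 92160 * (1 / 82944)), by positivity, fun μ t g g' ht hgm hgc hg ↦ ?_⟩
  have h1 := le_integral_one_sub_cos (a := t / 72) (b := 16 * t) (by positivity) (by positivity) μ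
    (fun s hs ↦ (hg s hs).1) hgc (fun s hs ↦ (hg s hs).2.1) (fun s hs ↦ (hg s hs).2.2)
  have hnn : ∀ s, 0 ≤ 1 - Real.cos (μ * g s) := fun s ↦ by linarith [Real.cos_le_one (μ * g s)]
  have hint : Integrable (fun s ↦ 1 - Real.cos (μ * g s)) (betaLaw p q) := by
    refine Integrable.of_bound (Measurable.aestronglyMeasurable (by fun_prop)) 2
      (Filter.Eventually.of_forall fun s ↦ ?_)
    rw [Real.norm_of_nonneg (hnn s)]
    linarith [Real.neg_one_le_cos (μ * g s)]
  have h2 := integral_mono_measure hle (Filter.Eventually.of_forall hnn) hint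
  rw [integral_smul_nnreal_measure, NNReal.smul_def, smul_eq_mul] at h2
  refine le_trans ?_ h2
  rw [mul_assoc]
  refine mul_le_mul_of_nonneg_left (le_trans ?_ h1) hc'.le
  have e1 : t / 72 / (80 * (16 * t)) = 1 / 92160 := by field_simp; norm_num
  have e2 : (μ * (t / 72) / 4) ^ 2 = 1 / 82944 * (μ * t) ^ 2 := by ring
  rw [e1, e2, mul_assoc]
  refine mul_le_mul_of_nonneg_left (le_min ?_ ?_) (by norm_num)
  · have := min_le_left 1 ((μ * t) ^ 2); linarith
  · exact mul_le_mul_of_nonneg_left (min_le_right _ _) (by norm_num)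

/-- For `t ≤ 1` the cosine of `μ L` is on average separated from `1` by `min 1 ((μ t) ^ 2)`. When
`β > -1/2` this comes from the angular variable, when `β = -1/2` from the radial one. -/
theorem exists_le_integral_one_sub_cos_logDist {α β : ℝ} (hα : -1 / 2 < α) (hβ : -1 / 2 ≤ β)
    (hβα : β ≤ α) : ∃ c : ℝ, 0 < c ∧ ∀ μ t : ℝ, 0 < t → t ≤ 1 →
      c * min 1 ((μ * t) ^ 2) ≤ ∫ p, (1 - Real.cos (μ * logDist t p)) ∂(jacobiMeasure α β) := by
  have := isProbabilityMeasure_betaLaw (p := β + 1) (q := α - β) (by linarith) (by linarith)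
  have := isProbabilityMeasure_betaLaw (p := 1 / 2) (q := β + 1 / 2) (by norm_num) (by linarith)
  have hint : ∀ μ t : ℝ, Integrable (fun p ↦ 1 - Real.cos (μ * logDist t p))
      ((betaLaw (β + 1) (α - β)).prod (betaLaw (1 / 2) (β + 1 / 2))) := fun μ t ↦
    integrable_comp_logDist hβ hβα (h := fun L ↦ 1 - Real.cos (μ * L)) (by fun_prop) t
  rcases hβ.eq_or_lt with hβ' | hβ'
  · obtain ⟨c, hc, h⟩ := exists_le_integral_betaLaw_one_sub_cos (p := β + 1) (q := α - β)
      (by linarith) (by linarith)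
    refine ⟨c, hc, fun μ t ht ht1 ↦ ?_⟩
    obtain ⟨g', hg'c, hg'⟩ := exists_hasDerivAt_logDist_fst ht ht1
    have h1 := h μ t _ g' ht ((measurable_logDist t).comp measurable_prodMk_right) hg'c hg'
    refine h1.trans (le_of_eq ?_)
    rw [jacobiMeasure, integral_prod _ (hint μ t), show β + 1 / 2 = 0 by linarith, betaLaw_zero]
    simp only [integral_dirac]
    rfl
  · obtain ⟨c, hc, h⟩ := exists_le_integral_betaLaw_one_sub_cos (p := 1 / 2) (q := β + 1 / 2)
      (by norm_num) (by linarith)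
    have hmass := betaLaw_real_Icc_pos (p := β + 1) (q := α - β) (by linarith) (by linarith)
    refine ⟨c * (betaLaw (β + 1) (α - β)).real (Icc (1 / 4 : ℝ) 1), by positivity,
      fun μ t ht ht1 ↦ ?_⟩
    rw [jacobiMeasure, integral_prod _ (hint μ t)]
    have hinner : ∀ r ∈ Icc (1 / 4 : ℝ) 1, c * min 1 ((μ * t) ^ 2) ≤
        ∫ s, (1 - Real.cos (μ * logDist t (r, s))) ∂(betaLaw (1 / 2) (β + 1 / 2)) := fun r hr ↦ by
      obtain ⟨g', hg'c, hg'⟩ := exists_hasDerivAt_logDist_snd ht ht1 hr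
      exact h μ t _ g' ht ((measurable_logDist t).comp measurable_prodMk_left) hg'c hg'
    have hI := (hint μ t).integral_prod_left
    calc c * (betaLaw (β + 1) (α - β)).real (Icc (1 / 4 : ℝ) 1) * min 1 ((μ * t) ^ 2)
        = ∫ _ in Icc (1 / 4 : ℝ) 1, c * min 1 ((μ * t) ^ 2) ∂(betaLaw (β + 1) (α - β)) := by
          rw [setIntegral_const, smul_eq_mul]; ring
      _ ≤ ∫ r in Icc (1 / 4 : ℝ) 1, ∫ s, (1 - Real.cos (μ * logDist t (r, s)))
            ∂(betaLaw (1 / 2) (β + 1 / 2)) ∂(betaLaw (β + 1) (α - β)) :=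
          setIntegral_mono_on (integrable_const _).integrableOn hI.integrableOn measurableSet_Icc
            hinner
      _ ≤ _ := setIntegral_le_integral hI (Filter.Eventually.of_forall fun r ↦
          integral_nonneg fun s ↦ by
            have := Real.cos_le_one (μ * logDist t (r, s))
            simp only [Pi.zero_apply]
            linarith)

/-! ### The lower bound for `|1 - φ|` -/

theorem mainTheorem5 (α β η₀ : ℝ) (hα : -1 / 2 < α) (hβ : -1 / 2 ≤ β) (hβα : β ≤ α)
    (hη₀ : 0 < η₀) (hη₀ρ : η₀ < jacobiRho α β) :
    ∃ C : ℝ, 0 < C ∧ ∀ μ η t : ℝ, |η| ≤ η₀ → 0 < t →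
      C * min 1 ((μ * t) ^ 2) ≤ ‖1 - jacobiFunction α β ((μ : ℂ) + Complex.I * (η : ℂ)) t‖ := by
  have := isProbabilityMeasure_jacobiMeasure hβ hβα
  obtain ⟨c, hc, hosc⟩ := exists_le_integral_one_sub_cos_logDist hα hβ hβα
  set ρ := jacobiRho α β with hρ
  have hρ0 : 0 < ρ := hη₀.trans hη₀ρ
  set L₀ := Real.log (Real.cosh 1) with hL₀
  have hL₀pos : 0 < L₀ := Real.log_pos (Real.one_lt_cosh.2 one_ne_zero)
  set d := (1 - Real.exp (-((ρ - η₀) * L₀))) ^ 2 / 2 with hd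
  have hdpos : 0 < d := by
    have : Real.exp (-((ρ - η₀) * L₀)) < 1 :=
      Real.exp_lt_one_iff.2 (by nlinarith)
    have : 0 < 1 - Real.exp (-((ρ - η₀) * L₀)) := by linarith
    positivity
  refine ⟨min (d / 2) (Real.exp (-ρ) * c / 2), by positivity, fun μ η t hη ht ↦ ?_⟩
  have hηρ : |η| ≤ ρ := hη.trans hη₀ρ.le
  have hm0 : 0 ≤ min 1 ((μ * t) ^ 2) := le_min zero_le_one (sq_nonneg _)
  have hre : 1 - (jacobiFunction α β ((μ : ℂ) + Complex.I * (η : ℂ)) t).re ≤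
      ‖1 - jacobiFunction α β ((μ : ℂ) + Complex.I * (η : ℂ)) t‖ := by
    simpa using Complex.re_le_norm (1 - jacobiFunction α β ((μ : ℂ) + Complex.I * (η : ℂ)) t)
  refine le_trans ?_ hre
  rw [one_sub_re_jacobiFunction hβ hβα, ← hρ]
  have hi : ∀ t, Integrable (fun p ↦ jacobiGap ρ μ η (logDist t p)) (jacobiMeasure α β) :=
    integrable_comp_logDist hβ hβα (continuous_jacobiGap ρ μ η)
  have hhalf : (∫ p, jacobiGap ρ μ η (logDist t p) ∂(jacobiMeasure α β)) / 2 ≤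
      ∫ p, (jacobiGap ρ μ η (logDist t p) + jacobiGap ρ μ η (logDist (-t) p)) / 2
        ∂(jacobiMeasure α β) := by
    rw [← integral_div]
    refine integral_mono ((hi t).div_const 2) (((hi t).add (hi (-t))).div_const 2) fun p ↦ ?_
    have := jacobiGap_nonneg hρ0.le hηρ μ (logDist (-t) p)
    simp only
    linarith
  refine le_trans ?_ hhalf
  rcases le_total 1 t with ht1 | ht1
  · have hint : d ≤ ∫ p, jacobiGap ρ μ η (logDist t p) ∂(jacobiMeasure α β) := by
      have : ∫ _, d ∂(jacobiMeasure α β) ≤ ∫ p, jacobiGap ρ μ η (logDist t p)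
          ∂(jacobiMeasure α β) := by
        refine integral_mono_ae (integrable_const _) (hi t) ?_
        filter_upwards [ae_jacobiMeasure_mem hβ hβα] with p hp
        refine sq_div_two_le_jacobiGap hη hη₀.le hη₀ρ μ hL₀pos (le_trans ?_
          (log_cosh_le_logDist ht.le hp.1.1))
        refine Real.log_le_log (Real.cosh_pos 1) (Real.cosh_le_cosh.2 ?_)
        rwa [abs_one, abs_of_pos ht]
      simpa using this
    calc min (d / 2) (Real.exp (-ρ) * c / 2) * min 1 ((μ * t) ^ 2) ≤ d / 2 * 1 := by
          gcongr
          · exact min_le_left _ _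
          · exact min_le_left _ _
      _ ≤ _ := by linarith
  · have hint : Real.exp (-ρ) * ∫ p, (1 - Real.cos (μ * logDist t p)) ∂(jacobiMeasure α β) ≤
        ∫ p, jacobiGap ρ μ η (logDist t p) ∂(jacobiMeasure α β) := by
      rw [← integral_const_mul]
      refine integral_mono_ae ((integrable_comp_logDist hβ hβα
        (h := fun L ↦ 1 - Real.cos (μ * L)) (by fun_prop) t).const_mul _) (hi t) ?_
      filter_upwards [ae_jacobiMeasure_mem hβ hβα] with p hp
      refine le_trans ?_ (mul_one_sub_cos_le_jacobiGap hρ0.le hηρ μ _)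
      have h1 := (abs_le.1 (abs_logDist_le t hp.1 hp.2)).2
      rw [abs_of_pos ht] at h1
      have h2 := Real.cos_le_one (μ * logDist t p)
      gcongr
      nlinarith
    calc min (d / 2) (Real.exp (-ρ) * c / 2) * min 1 ((μ * t) ^ 2)
        ≤ Real.exp (-ρ) * c / 2 * min 1 ((μ * t) ^ 2) := by
          gcongr
          exact min_le_right _ _
      _ = Real.exp (-ρ) * (c * min 1 ((μ * t) ^ 2)) / 2 := by ring
      _ ≤ Real.exp (-ρ) * (∫ p, (1 - Real.cos (μ * logDist t p)) ∂(jacobiMeasure α β)) / 2 := by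
          gcongr
          exact hosc μ t ht ht1
      _ ≤ _ := by linarith
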